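/- Let $\mathbb{H}^n=\mathbb{R}^n\times\mathbb{R}^n\times\mathbb{R}$ be the Heisenberg group with product $(x,y,t)(u,v,s)=(x+u,\,y+v,\,t+s+\tfrac12(u\cdot y-v\cdot x))$ and Lebesgue (Haar) measure, and write $L_a\varphi(X)=\varphi(a^{-1}X)$. For $\lambda\in\mathbb{R}\setminus\{0\}$ let $\pi_\lambda(x,y,t)u(\xi)=e^{2\pi i\lambda t}e^{2\pi i\lambda(x\cdot\xi+\frac12x\cdot y)}u(\xi+y)$ for $u\in L^2(\mathbb{R}^n)$. The group Fourier transform is $\widehat f(\lambda)=\int_{\mathbb{H}^n} f(X)\pi_\lambda(X)\,dX$ for $f\in L^1(\mathbb{H}^n)$, extended by density from $L^1\cap L^2$ to a map from $L^2(\mathbb{H}^n)$ to $L^2(\mathbb{R}\setminus\{0\},\mathcal{B}_2;|\lambda|^n d\lambda)$, where $\mathcal{B}_2$ is the space of Hilbert–Schmidt operators on $L^2(\mathbb{R}^n)$. For $\varphi\in L^2(\mathbb{H}^n)$ and $k,l\in\mathbb{Z}^n$ put $$G^\varphi_{k,l}(\lambda)=\sum_{r\in\mathbb{Z}}\big\langle\widehat\varphi(\lambda+r),\widehat{L_{(2k,l,0)}\varphi}(\lambda+r)\big\rangle_{\mathcal{B}_2}|\lambda+r|^n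 ,\qquad \Omega_\varphi=\{\lambda\in\mathbb{R}: G^\varphi_{0,0}(\lambda)>0\};$$ these are $1$-periodic in $\lambda$. We say that $\varphi$ satisfies Condition C if $G^\varphi_{k,l}=0$ a.e. on $(0,1]$ for all $(k,l)\in\mathbb{Z}^{2n}\setminus\{(0,0)\}$. A family $(e_i)$ is a frame for a closed subspace $V_0$ if all $e_i\in V_0$ and, for some constants $A',B'>0$, $A'\|f\|^2\le\sum_i|\langle f,e_i\rangle|^2\le B'\|f\|^2$ for all $f\in V_0$. **Theorem.** Let $V_0$ be a closed subspace of $L^2(\mathbb{H}^n)$. Let $\varphi\in L^2(\mathbb{H}^n)$ be continuous and satisfy Condition C, and let $\{L_{(2k,l,m)}\varphi:(k,l,m)\in\mathbb{Z}^n\times\mathbb{Z}^n\times\mathbb{Z}\}$ be a frame for $V_0$. Suppose that for each $(k,l)\in\mathbb{Z}^{2n}$ $$\sup_{X\in\mathbb{H}^n}\sum_{m\in\mathbb{Z}}|L_{(2k,l,m)}\varphi(X)|^2<\infty ,$$ and that there are constants $A,B>0$ with $$A\chi_{\Omega_\varphi}(\lambda)\le\sum_{(k,l)\in\mathbb{Z}^{2n}}|P_{k,l}(\lambda)|^2\le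 B\chi_{\Omega_\varphi}(\lambda)\quad\text{for a.e. }\lambda\in\mathbb{R},\qquad P_{k,l}(\lambda)=\sum_{m\in\mathbb{Z}}\varphi(2k,l,m)e^{2\pi i m\lambda},$$ the Fourier series $P_{k,l}$ being taken in $L^2(\mathbb{R}/\mathbb{Z})$. Then: 1. For each $(k,l)\in\mathbb{Z}^{2n}$ and each $(c_m)\in\ell^2(\mathbb{Z})$, the series $\sum_{m}c_mL_{(2k,l,m)}\varphi$ converges pointwise on $\mathbb{H}^n$ to a continuous function. 2. There is $\psi\in L^2(\mathbb{H}^n)$ satisfying Condition C such that $\{L_{(2k,l,m)}\psi:(k,l,m)\in\mathbb{Z}^n\times\mathbb{Z}^n\times\mathbb{Z}\}$ is a frame for $V_0$ and the following holds for every $f\in V_0$. The function $f$ has an expansion $f=\sum_{k,l,m}c_{2k,l,m}L_{(2k,l,m)}\varphi$ in $L^2(\mathbb{H}^n)$ with $(c_{2k,l,m})\in\ell^2(\mathbb{Z}^{2n+1})$. For every such expansion, the series $g_{2k,l}=\sum_{m}c_{2k,l,m}L_{(2k,l,m)}\varphi$ converge both in $L^2(\mathbb{H}^n)$ and pointwise,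 to the same continuous function, $f=\sum_{k,l}g_{2k,l}$ in $L^2(\mathbb{H}^n)$, and $$f=\sum_{(k,l,m)\in\mathbb{Z}^{2n+1}}\alpha_{2k,l,m}L_{(2k,l,m)}\psi\quad\text{in }L^2(\mathbb{H}^n),\qquad \alpha_{2k,l,m}=(g_{2k,l}*_d\widetilde\varphi)(2k,l,m),$$ where $\widetilde\varphi(X)=\overline{\varphi(X^{-1})}$ and the discrete convolution is the (absolutely convergent) sum $$(g_{2k,l}*_d\widetilde\varphi)(2k,l,m)=\sum_{(k'',l'',m'')\in\mathbb{Z}^{2n+1}}g_{2k,l}\big((2k,l,m)(2k'',l'',m'')^{-1}\big)\,\widetilde\varphi(2k'',l'',m'').$$ -/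

import Mathlib

open MeasureTheory Filter Topology
open scoped ENNReal

/-- The Heisenberg group `ℍⁿ`, with underlying manifold `ℝⁿ × ℝⁿ × ℝ`; points are `(x, y, t)`. -/
def Heis (n : ℕ) : Type := (Fin n → ℝ) × (Fin n → ℝ) × ℝ

namespace Heis

variable {n : ℕ}

instance : TopologicalSpace (Heis n) :=
  inferInstanceAs (TopologicalSpace ((Fin n → ℝ) × (Fin n → ℝ) × ℝ))

/-- The Lebesgue measure `dx dy dt`, which is the Haar measure of `ℍⁿ`. -/
noncomputable instance : MeasureSpace (Heis n) :=
  inferInstanceAs (MeasureSpace ((Fin n → ℝ) × (Fin n → ℝ) × ℝ))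

instance : BorelSpace (Heis n) :=
  inferInstanceAs (BorelSpace ((Fin n → ℝ) × (Fin n → ℝ) × ℝ))

/-- The point `(x, y, t)` of `ℍⁿ`. -/
def mk (x y : Fin n → ℝ) (t : ℝ) : Heis n := (x, y, t)

/-- The horizontal coordinate `x`. -/
def x (X : Heis n) : Fin n → ℝ := X.1

/-- The horizontal coordinate `y`. -/
def y (X : Heis n) : Fin n → ℝ := X.2.1

/-- The central coordinate `t`. -/
def t (X : Heis n) : ℝ := X.2.2

/-- Group law `(x,y,t)(u,v,s) = (x+u, y+v, t+s+½(u·y - v·x))`. -/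
noncomputable instance : Mul (Heis n) :=
  ⟨fun X Y => mk (X.x + Y.x) (X.y + Y.y) (X.t + Y.t + (1 / 2) * (Y.x ⬝ᵥ X.y - Y.y ⬝ᵥ X.x))⟩

instance : One (Heis n) := ⟨mk 0 0 0⟩

instance : Inv (Heis n) := ⟨fun X => mk (-X.x) (-X.y) (-X.t)⟩

@[ext] theorem ext {X Y : Heis n} (hx : X.x = Y.x) (hy : X.y = Y.y) (ht : X.t = Y.t) : X = Y :=
  Prod.ext hx (Prod.ext hy ht)

@[simp] theorem x_mk (a b : Fin n → ℝ) (c : ℝ) : (mk a b c).x = a := rfl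
@[simp] theorem y_mk (a b : Fin n → ℝ) (c : ℝ) : (mk a b c).y = b := rfl
@[simp] theorem t_mk (a b : Fin n → ℝ) (c : ℝ) : (mk a b c).t = c := rfl
@[simp] theorem x_mul (X Y : Heis n) : (X * Y).x = X.x + Y.x := rfl
@[simp] theorem y_mul (X Y : Heis n) : (X * Y).y = X.y + Y.y := rfl
@[simp] theorem t_mul (X Y : Heis n) :
    (X * Y).t = X.t + Y.t + (1 / 2) * (Y.x ⬝ᵥ X.y - Y.y ⬝ᵥ X.x) := rfl
@[simp] theorem x_one : (1 : Heis n).x = 0 := rfl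
@[simp] theorem y_one : (1 : Heis n).y = 0 := rfl
@[simp] theorem t_one : (1 : Heis n).t = 0 := rfl
@[simp] theorem x_inv (X : Heis n) : X⁻¹.x = -X.x := rfl
@[simp] theorem y_inv (X : Heis n) : X⁻¹.y = -X.y := rfl
@[simp] theorem t_inv (X : Heis n) : X⁻¹.t = -X.t := rfl

noncomputable instance : Group (Heis n) :=
  Group.ofLeftAxioms
    (fun X Y Z => by
      ext i
      · simp [add_assoc]
      · simp [add_assoc]
      · simp [dotProduct_add, add_dotProduct]; ring)
    (fun X => by ext i <;> simp)
    (fun X => by ext i <;> simp [dotProduct_comm])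

/-- Left translation of a function: `L_a φ (X) = φ (a⁻¹ X)`. -/
noncomputable def leftTranslate (a : Heis n) (φ : Heis n → ℂ) : Heis n → ℂ := fun X => φ (a⁻¹ * X)

/-- Left multiplication preserves the Lebesgue measure. -/
theorem measurePreserving_mul_left (a : Heis n) :
    MeasurePreserving (fun X : Heis n => a * X) volume volume := by
  have key : MeasurePreserving
      (fun p : (Fin n → ℝ) × (Fin n → ℝ) × ℝ =>
        (a.x + p.1, a.y + p.2.1, (a.t + (1 / 2) * (p.1 ⬝ᵥ a.y - p.2.1 ⬝ᵥ a.x)) + p.2.2))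
      volume volume := by
    refine (measurePreserving_add_left volume a.x).skew_product
      (g := fun (u : Fin n → ℝ) (q : (Fin n → ℝ) × ℝ) =>
        (a.y + q.1, (a.t + (1 / 2) * (u ⬝ᵥ a.y - q.1 ⬝ᵥ a.x)) + q.2)) ?_ ?_
    · refine Continuous.measurable ?_
      simp only [Function.uncurry_def, dotProduct]
      fun_prop
    · refine Filter.Eventually.of_forall fun u => ?_
      refine ((measurePreserving_add_left volume a.y).skew_product
        (g := fun (v : Fin n → ℝ) (s : ℝ) =>
          (a.t + (1 / 2) * (u ⬝ᵥ a.y - v ⬝ᵥ a.x)) + s) ?_ ?_).map_eq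
      · refine Continuous.measurable ?_
        simp only [Function.uncurry_def, dotProduct]
        fun_prop
      · exact Filter.Eventually.of_forall fun v =>
          (measurePreserving_add_left volume _).map_eq
  have e : (fun X : Heis n => a * X) =
      (fun p : (Fin n → ℝ) × (Fin n → ℝ) × ℝ =>
        (a.x + p.1, a.y + p.2.1, (a.t + (1 / 2) * (p.1 ⬝ᵥ a.y - p.2.1 ⬝ᵥ a.x)) + p.2.2)) := by
    funext X
    refine ext rfl rfl ?_
    change a.t + X.t + _ = _ + X.t
    change _ = (a.t + (1 / 2) * (X.x ⬝ᵥ a.y - X.y ⬝ᵥ a.x)) + X.t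
    ring
  rw [e]
  exact key

theorem memLp_leftTranslate (a : Heis n) {φ : Heis n → ℂ} (hφ : MemLp φ 2 volume) :
    MemLp (leftTranslate a φ) 2 volume :=
  hφ.comp_measurePreserving (measurePreserving_mul_left a⁻¹)

/-- `φ̃(X) = conj (φ (X⁻¹))`. -/
noncomputable def involution (φ : Heis n → ℂ) : Heis n → ℂ := fun X => star (φ X⁻¹)

/-- The point `(2k, l, m)` of the standard lattice. -/
def lat (k l : Fin n → ℤ) (m : ℤ) : Heis n :=
  mk (fun i => 2 * (k i : ℝ)) (fun i => (l i : ℝ)) (m : ℝ)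

/-- Discrete convolution over the lattice `{(2k, l, m)}`:
`(g *_d h)(X) = ∑_{k,l,m} g (X (2k,l,m)⁻¹) h(2k,l,m)`. -/
noncomputable def discreteConv (g h : Heis n → ℂ) (X : Heis n) : ℂ :=
  ∑' p : (Fin n → ℤ) × (Fin n → ℤ) × ℤ,
    g (X * (lat p.1 p.2.1 p.2.2)⁻¹) * h (lat p.1 p.2.1 p.2.2)

/-- The space `L²(ℍⁿ)`. -/
noncomputable abbrev L2 (n : ℕ) : Type := Lp ℂ 2 (volume : Measure (Heis n))

/-- The family of lattice translates `L_{(2k,l,m)} φ` as elements of `L²(ℍⁿ)`. -/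
noncomputable def latticeTranslates {φ : Heis n → ℂ} (hφ : MemLp φ 2 volume)
    (p : (Fin n → ℤ) × (Fin n → ℤ) × ℤ) : L2 n :=
  (memLp_leftTranslate (lat p.1 p.2.1 p.2.2) hφ).toLp

/-! ### The group Fourier transform -/

/-- The representation space `L²(ℝⁿ)`. -/
noncomputable abbrev RepSpace (n : ℕ) : Type := Lp ℂ 2 (volume : Measure (Fin n → ℝ))

/-- The function `ξ ↦ e^{2πiλt} e^{2πiλ(x·ξ + ½ x·y)} u(ξ + y)`. -/
noncomputable def schrodingerFun (lam : ℝ) (X : Heis n) (u : (Fin n → ℝ) → ℂ) :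
    (Fin n → ℝ) → ℂ := fun ξ =>
  Complex.exp (2 * Real.pi * Complex.I * lam * X.t) *
    Complex.exp (2 * Real.pi * Complex.I * lam *
      ((X.x ⬝ᵥ ξ + (1 / 2) * (X.x ⬝ᵥ X.y) : ℝ) : ℂ)) * u (ξ + X.y)

theorem norm_schrodingerFun (lam : ℝ) (X : Heis n) (u : (Fin n → ℝ) → ℂ) (ξ : Fin n → ℝ) :
    ‖schrodingerFun lam X u ξ‖ = ‖u (ξ + X.y)‖ := by
  have h (r : ℝ) : ‖Complex.exp (2 * Real.pi * Complex.I * lam * r)‖ = 1 := by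
    have := Complex.norm_exp_ofReal_mul_I (2 * Real.pi * lam * r)
    rw [← this]; congr 2; push_cast; ring
  rw [schrodingerFun, norm_mul, norm_mul, h, h, one_mul, one_mul]

theorem memLp_schrodingerFun (lam : ℝ) (X : Heis n) {u : (Fin n → ℝ) → ℂ}
    (hu : MemLp u 2 volume) : MemLp (schrodingerFun lam X u) 2 volume := by
  have h1 : MemLp (fun ξ => u (ξ + X.y)) 2 volume :=
    hu.comp_measurePreserving (measurePreserving_add_right volume X.y)
  refine h1.congr_norm ?_ (Filter.Eventually.of_forall fun ξ => (norm_schrodingerFun _ _ _ _).symm)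
  refine AEStronglyMeasurable.mul ?_ h1.1
  refine Continuous.aestronglyMeasurable ?_
  simp only [dotProduct]
  fun_prop

theorem schrodingerFun_congr (lam : ℝ) (X : Heis n) {u v : (Fin n → ℝ) → ℂ}
    (h : u =ᵐ[volume] v) : schrodingerFun lam X u =ᵐ[volume] schrodingerFun lam X v := by
  filter_upwards [(measurePreserving_add_right volume X.y).quasiMeasurePreserving.ae_eq h]
    with ξ hξ
  have hξ' : u (ξ + X.y) = v (ξ + X.y) := hξ
  simp only [schrodingerFun, hξ']

/-- The Schrödinger representation
`π_λ(x,y,t) u (ξ) = e^{2πiλt} e^{2πiλ(x·ξ + ½ x·y)} u(ξ + y)` on `L²(ℝⁿ)`. -/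
noncomputable def schrodinger (lam : ℝ) (X : Heis n) : RepSpace n →ₗᵢ[ℂ] RepSpace n where
  toFun u := (memLp_schrodingerFun lam X (Lp.memLp u)).toLp
  map_add' u v := by
    rw [← MemLp.toLp_add]
    refine MemLp.toLp_congr _ _ ?_
    refine (schrodingerFun_congr lam X (Lp.coeFn_add u v)).trans ?_
    refine Filter.Eventually.of_forall fun ξ => ?_
    simp only [schrodingerFun, Pi.add_apply]; ring
  map_smul' c u := by
    rw [RingHom.id_apply, ← MemLp.toLp_const_smul]
    refine MemLp.toLp_congr _ _ ?_
    refine (schrodingerFun_congr lam X (Lp.coeFn_smul c u)).trans ?_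
    refine Filter.Eventually.of_forall fun ξ => ?_
    simp only [schrodingerFun, Pi.smul_apply, smul_eq_mul]; ring
  norm_map' u := by
    change ‖(memLp_schrodingerFun lam X (Lp.memLp u)).toLp‖ = ‖u‖
    rw [Lp.norm_toLp, Lp.norm_def]
    congr 1
    rw [eLpNorm_congr_norm_ae
      (Filter.Eventually.of_forall fun ξ => norm_schrodingerFun lam X u ξ)]
    exact eLpNorm_comp_measurePreserving (Lp.aestronglyMeasurable u)
      (measurePreserving_add_right volume X.y)

/-- The index set of a fixed orthonormal basis of `L²(ℝⁿ)`. -/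
noncomputable def basisIndex (n : ℕ) : Set (RepSpace n) :=
  (exists_hilbertBasis ℂ (RepSpace n)).choose

/-- A fixed orthonormal (Hilbert) basis of `L²(ℝⁿ)`. -/
noncomputable def basis (n : ℕ) : HilbertBasis (basisIndex n) ℂ (RepSpace n) :=
  (exists_hilbertBasis ℂ (RepSpace n)).choose_spec.choose

/-- The squared Hilbert–Schmidt norm `∑ ‖T eᵢ‖²` of an operator on `L²(ℝⁿ)`; it is infinite
when `T` is not Hilbert–Schmidt, and does not depend on the orthonormal basis. -/
noncomputable def hsNormSq (T : RepSpace n → RepSpace n) : ℝ≥0∞ :=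
  ∑' i, ‖T (basis n i)‖ₑ ^ 2

/-- The Hilbert–Schmidt inner product `⟨S, T⟩ = tr (T* S) = ∑ ⟨S eᵢ, T eᵢ⟩`, linear in `S`
(Mathlib's `inner` is linear in its second argument). -/
noncomputable def hsInner (S T : RepSpace n →L[ℂ] RepSpace n) : ℂ :=
  ∑' i, inner ℂ (T (basis n i)) (S (basis n i))

/-- The group Fourier transform of an integrable function: the operator
`f̂(λ) u = ∫ f(X) π_λ(X) u dX` on `L²(ℝⁿ)`, a Bochner integral in `L²(ℝⁿ)`. -/
noncomputable def fourierL1 (f : Heis n → ℂ) (lam : ℝ) (u : RepSpace n) : RepSpace n :=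
  ∫ X : Heis n, f X • schrodinger lam X u

/-- `F` is (a version of) the group Fourier transform of `f ∈ L²(ℍⁿ)`, the extension by density
from `L¹ ∩ L²`: the field of operators `F` is measurable and is the limit of `ĝⱼ` in
`L²(ℝ*, 𝓑₂; |λ|ⁿ dλ)` for some `gⱼ ∈ L¹ ∩ L²` converging to `f` in `L²(ℍⁿ)`. -/
def IsFourier (f : Heis n → ℂ) (F : ℝ → RepSpace n →L[ℂ] RepSpace n) : Prop :=
  (∀ u v : RepSpace n, AEMeasurable (fun lam => inner ℂ v (F lam u)) volume) ∧
  ∃ g : ℕ → Heis n → ℂ,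
    (∀ j, Integrable (g j) volume ∧ MemLp (g j) 2 volume) ∧
    Tendsto (fun j => eLpNorm (g j - f) 2 volume) atTop (𝓝 0) ∧
    Tendsto (fun j => ∫⁻ lam : ℝ,
      hsNormSq (fun u => F lam u - fourierL1 (g j) lam u) * ‖lam‖ₑ ^ n) atTop (𝓝 0)

open Classical in
/-- The group Fourier transform `f̂` of `f ∈ L²(ℍⁿ)`, unique up to a null set of `λ`. -/
noncomputable def fourier (f : Heis n → ℂ) : ℝ → RepSpace n →L[ℂ] RepSpace n :=
  if h : ∃ F, IsFourier f F then h.choose else 0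

/-- `G^φ_{k,l}(λ) = ∑_{r ∈ ℤ} ⟨φ̂(λ+r), (L_{(2k,l,0)}φ)^(λ+r)⟩ |λ+r|ⁿ`. The formula is used for
every real `λ`, so `G^φ_{k,l}` is `1`-periodic. -/
noncomputable def G (φ : Heis n → ℂ) (k l : Fin n → ℤ) (lam : ℝ) : ℂ :=
  ∑' r : ℤ, hsInner (fourier φ (lam + r)) (fourier (leftTranslate (lat k l 0) φ) (lam + r)) *
    ((|lam + r| ^ n : ℝ) : ℂ)

/-- Condition C: `G^φ_{k,l} = 0` a.e. on `(0, 1]` for all `(k,l) ≠ (0,0)`. -/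
def ConditionC (φ : Heis n → ℂ) : Prop :=
  ∀ k l : Fin n → ℤ, (k, l) ≠ (0, 0) →
    ∀ᵐ lam ∂(volume.restrict (Set.Ioc (0 : ℝ) 1)), G φ k l lam = 0

/-- `Ω_φ = {λ ∈ ℝ : G^φ_{0,0}(λ) > 0}` (`G^φ_{0,0}` is real-valued). -/
def Omega (φ : Heis n → ℂ) : Set ℝ := {lam | 0 < (G φ 0 0 lam).re}

/-- `P_{k,l} = ∑_m φ(2k,l,m) e^{2πimλ}`, the Fourier series converging in `L²(ℝ/ℤ)`. -/
noncomputable def P (φ : Heis n → ℂ) (k l : Fin n → ℤ) :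
    Lp ℂ 2 (AddCircle.haarAddCircle (T := (1 : ℝ))) :=
  ∑' m : ℤ, φ (lat k l m) • fourierLp 2 m

/-- `‖P(λ)‖² = ∑_{k,l} |P_{k,l}(λ)|²`, the squared `ℓ²(ℤ²ⁿ)` norm, possibly infinite. -/
noncomputable def normSqP (φ : Heis n → ℂ) (lam : ℝ) : ℝ≥0∞ :=
  ∑' q : (Fin n → ℤ) × (Fin n → ℤ), ‖P φ q.1 q.2 (lam : AddCircle (1 : ℝ))‖ₑ ^ 2

end Heis

/-- The family `e` is a frame for the closed subspace `V`: it lies in `V` and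
`A ‖f‖² ≤ ∑ |⟨f, eᵢ⟩|² ≤ B ‖f‖²` for all `f ∈ V`, with constants `A, B > 0`. -/
def IsFrameFor {E ι : Type*} [NormedAddCommGroup E] [InnerProductSpace ℂ E]
    (V : Submodule ℂ E) (e : ι → E) : Prop :=
  (∀ i, e i ∈ V) ∧ ∃ A B : ℝ, 0 < A ∧ 0 < B ∧ ∀ f ∈ V,
    ENNReal.ofReal (A * ‖f‖ ^ 2) ≤ (∑' i, ‖inner ℂ (e i) f‖ₑ ^ 2) ∧
    (∑' i, ‖inner ℂ (e i) f‖ₑ ^ 2) ≤ ENNReal.ofReal (B * ‖f‖ ^ 2)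

/-! Translates along the centre are governed by functions on the circle. The Bessel bound gives a
bounded operator `S` from L²(ℝ/ℤ) to L²(ℍⁿ) sending the character e_m to L_{(0,0,m)}φ. The
translates over a fixed (k,l) are the functions L_{(2k,l,0)} S e_m, and central translation by m
corresponds under `S` to multiplication by e_m. By Plancherel on ℍⁿ, the Fourier coefficients of
G_{k,l} are the inner products of φ with L_{(2k,l,m)}φ (`fourierCoeff_specDensity`). Hence Condition
C expresses the orthogonality of the blocks attached to different (k,l) (`conditionC_iff`), and S*S
is multiplication by G_{0,0} (`adjoint_circleSynthesis`), so that S h depends only on the values of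
h over Ω_φ.

Let p = ∑ |P_{k,l}|² and write g_{2k,l} = L_{(2k,l,0)} S h, where h has Fourier coefficients
c_{2k,l,m}. Lattice points over the same (k,l) differ by a central element, so the value of g_{2k,l}
at (2k,l,m)(2k',l',s) is the Fourier coefficient of h P_{k',l'} at s + m. Pairing these with the
coefficients of P_{k',l'} and applying Parseval shows that the discrete convolution at (2k,l,m) is
the m-th Fourier coefficient of p h (`hasSum_convolution`, `hasSum_discreteConv`). The window ψ =
S(1/p), with 1/p read as 0 off Ω_φ, undoes the factor p: summing these coefficients against the
translates of ψ gives L_{(2k,l,0)} S(p⁻¹ p h) = g_{2k,l}. Since A ≤ p ≤ B on Ω_φ, multiplication by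
p and by 1/p is bounded, which carries the frame property from φ to ψ (`isFrameFor_dual`). Condition
C passes to ψ because its translates stay in the same blocks.

Pointwise convergence is Cauchy–Schwarz against the supremum bound
(`exists_continuous_hasSum_of_bounded`). Plancherel on ℍⁿ is derived from the Euclidean theorem: the
operator of f at λ has as kernel a partial Fourier transform of f in (x,t), and its Hilbert–Schmidt
norm is the L² norm of that kernel (`lintegral_tsum_fourierL1_sq`). -/

section

open scoped FourierTransform SchwartzMap

/-! ### Euclidean Plancherel on L¹ ∩ L². -/

section EuclideanPlancherel

variable {V : Type*} [NormedAddCommGroup V] [InnerProductSpace ℝ V] [FiniteDimensional ℝ V]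
  [MeasurableSpace V] [BorelSpace V]

/-- Both sides define the same distribution: tested on a smooth compactly supported function, the
transform moves onto the test function, by definition on the L² side and by Fubini on the L¹ side.
-/
theorem coeFn_fourier_toLp {f : V → ℂ} (h1 : Integrable f) (h2 : MemLp f 2 volume) :
    (𝓕 h2.toLp : Lp ℂ 2 (volume : Measure V)) =ᵐ[volume] 𝓕 f := by
  have hc : Continuous (𝓕 f) :=
    VectorFourier.fourierIntegral_continuous Real.continuous_fourierChar (by exact
        continuous_inner) h1
  refine ae_eq_of_integral_contDiff_smul_eq
    ((Lp.memLp (𝓕 h2.toLp : Lp ℂ 2 (volume : Measure V))).locallyIntegrable (by norm_num))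
    hc.locallyIntegrable fun g hg hgc => ?_
  have key := Lp.fourier_toTemperedDistribution_eq (h2.toLp)
  have hg' : ContDiff ℝ ((⊤ : ℕ∞) : WithTop ℕ∞) (fun x => (g x : ℂ)) :=
      Complex.ofRealCLM.contDiff.comp hg
  have hgc' : HasCompactSupport (fun x => (g x : ℂ)) := hgc.comp_left Complex.ofReal_zero
  let s : 𝓢(V, ℂ) := hgc'.toSchwartzMap hg'
  have k2 := congrArg (fun T => T s) key
  simp only [TemperedDistribution.fourier_apply, Lp.toTemperedDistribution_apply] at k2
  have k3 : ∫ x, (𝓕 s : 𝓢(V, ℂ)) x • ((h2.toLp : V → ℂ) x) = ∫ x, s x • 𝓕 f x := by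
    have e1 : ∫ x, (𝓕 s : 𝓢(V, ℂ)) x • ((h2.toLp : V → ℂ) x) = ∫ x, 𝓕 (s : V → ℂ) x • f x := by
      refine integral_congr_ae ?_
      filter_upwards [h2.coeFn_toLp] with x hx
      rw [hx, SchwartzMap.fourier_coe]
    rw [e1]
    exact VectorFourier.integral_fourierIntegral_smul_eq_flip (L := innerₗ V)
      Real.continuous_fourierChar (by exact continuous_inner) s.integrable h1 |>.trans (by
        simp only [flip_innerₗ]; rfl)
  have e2 (x : V) : s x = (g x : ℂ) := rfl
  rw [k3] at k2
  simp only [e2] at k2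
  simpa using k2.symm

theorem lintegral_enorm_fourier_sq {f : V → ℂ} (h1 : Integrable f) (h2 : MemLp f 2 volume) :
    ∫⁻ x, ‖𝓕 f x‖ₑ ^ 2 = ∫⁻ x, ‖f x‖ₑ ^ 2 := by
  have e (g : V → ℂ) : eLpNorm g 2 volume ^ 2 = ∫⁻ x, ‖g x‖ₑ ^ 2 := by
    have := eLpNorm_nnreal_pow_eq_lintegral (f := g) (μ := (volume : Measure V)) (p := 2) (by
        norm_num)
    simpa using this
  rw [← e, ← e, ← eLpNorm_congr_ae (coeFn_fourier_toLp h1 h2)]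
  have := Lp.norm_fourier_eq h2.toLp
  rw [Lp.norm_def, Lp.norm_def, ENNReal.toReal_eq_toReal_iff' (Lp.eLpNorm_ne_top _)
    (Lp.eLpNorm_ne_top _), eLpNorm_congr_ae h2.coeFn_toLp] at this
  rw [this]

end EuclideanPlancherel

/-- The product `(Fin n → ℝ) × ℝ` carries a sup norm, so the statement is transported along a
volume-preserving map from the corresponding Euclidean space. -/
theorem lintegral_enorm_fourier_prod_sq {n : ℕ} {h : (Fin n → ℝ) × ℝ → ℂ} (h1 : Integrable h)
    (h2 : MemLp h 2 volume) :
    ∫⁻ p : (Fin n → ℝ) × ℝ, ‖∫ q : (Fin n → ℝ) × ℝ,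
      Complex.exp (2 * Real.pi * Complex.I * ((q.2 * p.2 + q.1 ⬝ᵥ p.1 : ℝ) : ℂ)) * h q‖ₑ ^ 2 =
    ∫⁻ q, ‖h q‖ₑ ^ 2 := by
  let e : WithLp 2 (EuclideanSpace ℝ (Fin n) × ℝ) → (Fin n → ℝ) × ℝ :=
    fun v => (WithLp.ofLp (WithLp.ofLp v).1, (WithLp.ofLp v).2)
  have he : MeasurePreserving e volume volume :=
    ((PiLp.volume_preserving_ofLp (Fin n)).prod (MeasurePreserving.id volume)).comp
      (WithLp.volume_preserving_ofLp (EuclideanSpace ℝ (Fin n)) ℝ)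
  have hem : MeasurableEmbedding e := by
    refine MeasurableEmbedding.comp (g := fun v : EuclideanSpace ℝ (Fin n) × ℝ =>
      ((MeasurableEquiv.toLp 2 (Fin n → ℝ)).symm v.1, v.2)) (f := WithLp.ofLp) ?_ ?_
    · exact ((MeasurableEquiv.toLp 2 (Fin n → ℝ)).symm.prodCongr
        (MeasurableEquiv.refl ℝ)).measurableEmbedding
    · exact (MeasurableEquiv.toLp 2 (EuclideanSpace ℝ (Fin n) × ℝ)).symm.measurableEmbedding
  have := lintegral_enorm_fourier_sq (he.integrable_comp_of_integrable h1)
    (h2.comp_measurePreserving he)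
  have r : ∫⁻ x, ‖(h ∘ e) x‖ₑ ^ 2 = ∫⁻ q, ‖h q‖ₑ ^ 2 :=
    he.lintegral_comp_emb hem (fun q => ‖h q‖ₑ ^ 2)
  rw [r] at this
  rw [← this]
  -- The kernel here is e^{+2πi⟨·,·⟩} while `𝓕` uses the opposite sign; the reflection of the
  -- frequency variable absorbs the difference.
  rw [← he.lintegral_comp_emb hem (fun p => ‖∫ q : (Fin n → ℝ) × ℝ, _‖ₑ ^ 2),
    ← lintegral_neg_eq_self]
  refine lintegral_congr fun w => ?_
  congr 2
  rw [← he.integral_comp hem, Real.fourier_eq']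
  refine integral_congr_ae (Eventually.of_forall fun v => ?_)
  simp only [smul_eq_mul, Function.comp]
  congr 2
  have : inner ℝ v w = (e v).2 * (e w).2 + (e v).1 ⬝ᵥ (e w).1 := by
    rw [WithLp.prod_inner_apply, PiLp.inner_apply, add_comm]
    simp [e, dotProduct, mul_comm]
  rw [this]
  have e1 : (e (-w)).2 = -(e w).2 := rfl
  have e2 : (e (-w)).1 = -(e w).1 := rfl
  rw [e1, e2]
  simp only [dotProduct_neg]
  push_cast
  ring

end

theorem eLpNorm_two_sq {α E : Type*} [MeasurableSpace α] [NormedAddCommGroup E] (μ : Measure α)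
    (f : α → E) : eLpNorm f 2 μ ^ 2 = ∫⁻ x, ‖f x‖ₑ ^ 2 ∂μ := by
  have := eLpNorm_nnreal_pow_eq_lintegral (f := f) (μ := μ) (p := 2) (by norm_num)
  simpa using this

theorem MeasureTheory.Lp.enorm_sq {α E : Type*} [MeasurableSpace α] [NormedAddCommGroup E]
    {μ : Measure α} (f : Lp E 2 μ) : ‖f‖ₑ ^ 2 = ∫⁻ x, ‖f x‖ₑ ^ 2 ∂μ := by
  rw [Lp.enorm_def, eLpNorm_two_sq]

/-! ### Measurability of the Schrödinger representation; Fourier operators as pointwise integrals.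
-/

namespace Heis

variable {n : ℕ}

instance : SecondCountableTopology (Heis n) :=
  inferInstanceAs (SecondCountableTopology ((Fin n → ℝ) × (Fin n → ℝ) × ℝ))

instance : SFinite (volume : Measure (Heis n)) :=
  inferInstanceAs (SFinite (volume : Measure ((Fin n → ℝ) × (Fin n → ℝ) × ℝ)))

@[fun_prop] theorem continuous_x : Continuous (x : Heis n → _) :=
  (continuous_fst : Continuous (Prod.fst : (Fin n → ℝ) × (Fin n → ℝ) × ℝ → _))

@[fun_prop] theorem continuous_y : Continuous (y : Heis n → _) :=
  (continuous_fst.comp continuous_snd :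
    Continuous (fun p : (Fin n → ℝ) × (Fin n → ℝ) × ℝ => p.2.1))

@[fun_prop] theorem continuous_t : Continuous (t : Heis n → _) :=
  (continuous_snd.comp continuous_snd :
    Continuous (fun p : (Fin n → ℝ) × (Fin n → ℝ) × ℝ => p.2.2))

@[fun_prop] theorem measurable_y : Measurable (y : Heis n → _) := continuous_y.measurable

/-- Orthonormal vectors lie at distance √2, so the balls of radius 1/2 around them are disjoint open
sets in a separable space. Countability lets sums over the basis pass through integrals and
almost-everywhere statements. -/
instance : Countable (basisIndex n) := by
  have hb := (basis n).orthonormal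
  have : Fact ((2 : ℝ≥0∞) ≠ ⊤) := ⟨by norm_num⟩
  refine Pairwise.countable_of_isOpen_disjoint (s := fun i => Metric.ball (basis n i) (1 / 2))
    (fun i j hij => ?_) (fun _ => Metric.isOpen_ball) (fun i => ⟨_, Metric.mem_ball_self (by
        norm_num)⟩)
  refine Metric.ball_disjoint_ball ?_
  have h : ‖basis n i - basis n j‖ ^ 2 = 2 := by
    rw [@norm_sub_sq ℂ, hb.1 i, hb.1 j, hb.2 hij]; norm_num
  rw [dist_eq_norm]
  nlinarith [norm_nonneg (basis n i - basis n j)]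

theorem schrodinger_coeFn (lam : ℝ) (X : Heis n) (u : RepSpace n) :
    schrodinger lam X u =ᵐ[volume] schrodingerFun lam X u :=
  (memLp_schrodingerFun lam X (Lp.memLp u)).coeFn_toLp

theorem measurable_schrodingerFun {u : (Fin n → ℝ) → ℂ} (hu : Measurable u) :
    Measurable (fun p : (ℝ × Heis n) × (Fin n → ℝ) => schrodingerFun p.1.1 p.1.2 u p.2) := by
  unfold schrodingerFun
  refine Measurable.mul (Continuous.measurable ?_) (hu.comp (by fun_prop))
  simp only [dotProduct]
  fun_prop

theorem stronglyMeasurable_of_inner {α : Type*} [MeasurableSpace α] {f : α → RepSpace n}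
    (h : ∀ v, Measurable fun a => inner ℂ v (f a)) : StronglyMeasurable f := by
  refine stronglyMeasurable_of_tendsto (atTop : Filter (Finset (basisIndex n)))
    (f := fun s a => ∑ i ∈ s, inner ℂ (basis n i) (f a) • basis n i) (fun s => ?_) ?_
  · refine Finset.stronglyMeasurable_fun_sum _ fun i _ => ?_
    exact (h _).stronglyMeasurable.smul stronglyMeasurable_const
  · refine tendsto_pi_nhds.mpr fun a => ?_
    have := (basis n).hasSum_repr (f a)
    simp only [HilbertBasis.repr_apply_apply] at this
    exact this

theorem aestronglyMeasurable_of_inner {α : Type*} [MeasurableSpace α] {μ : Measure α}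
    {f : α → RepSpace n}
    (h : ∀ v, AEMeasurable (fun a => inner ℂ v (f a)) μ) : AEStronglyMeasurable f μ := by
  refine aestronglyMeasurable_of_tendsto_ae (atTop : Filter (Finset (basisIndex n)))
    (f := fun s a => ∑ i ∈ s, inner ℂ (basis n i) (f a) • basis n i) (fun s => ?_) ?_
  · refine Finset.aestronglyMeasurable_fun_sum _ fun i _ => ?_
    exact (h _).aestronglyMeasurable.smul aestronglyMeasurable_const
  · refine Eventually.of_forall fun a => ?_
    have := (basis n).hasSum_repr (f a)
    simp only [HilbertBasis.repr_apply_apply] at this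
    exact this

theorem stronglyMeasurable_schrodinger (u : RepSpace n) :
    StronglyMeasurable (fun p : ℝ × Heis n => schrodinger p.1 p.2 u) := by
  refine stronglyMeasurable_of_inner fun v => ?_
  have e (p : ℝ × Heis n) : inner ℂ v (schrodinger p.1 p.2 u) =
      ∫ ξ, inner ℂ (v ξ) (schrodingerFun p.1 p.2 u ξ) := by
    rw [L2.inner_def]
    refine integral_congr_ae ?_
    filter_upwards [schrodinger_coeFn p.1 p.2 u] with ξ hξ
    rw [hξ]
  simp only [e]
  refine (StronglyMeasurable.integral_prod_right (f := fun (p : ℝ × Heis n) ξ =>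
    inner ℂ (v ξ) (schrodingerFun p.1 p.2 u ξ)) ?_).measurable
  refine Measurable.stronglyMeasurable ?_
  refine Measurable.inner ((Lp.stronglyMeasurable v).measurable.comp measurable_snd) ?_
  exact measurable_schrodingerFun (Lp.stronglyMeasurable u).measurable

theorem fourierL1_congr {g h : Heis n → ℂ} (e : g =ᵐ[volume] h) : fourierL1 g = fourierL1 h := by
  funext lam u
  exact integral_congr_ae (e.mono fun X hX => by simp only [hX])

theorem stronglyMeasurable_fourierL1 {g : Heis n → ℂ} (hg : AEStronglyMeasurable g volume)
    (u : RepSpace n) : StronglyMeasurable (fun lam => fourierL1 g lam u) := by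
  rw [fourierL1_congr hg.ae_eq_mk]
  unfold fourierL1
  refine StronglyMeasurable.integral_prod_right (f := fun lam X => hg.mk g X • schrodinger lam X
      u) ?_
  have h1 : StronglyMeasurable (fun p : ℝ × Heis n => hg.mk g p.2) :=
    hg.stronglyMeasurable_mk.comp_measurable measurable_snd
  exact h1.smul (stronglyMeasurable_schrodinger u)

theorem integrable_smul_schrodinger {g : Heis n → ℂ} (hg : Integrable g volume) (lam : ℝ)
    (u : RepSpace n) : Integrable (fun X => g X • schrodinger lam X u) volume := by
  refine (hg.norm.mul_const ‖u‖).mono' (hg.1.smul ?_) ?_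
  · exact ((stronglyMeasurable_schrodinger u).comp_measurable
      measurable_prodMk_left).aestronglyMeasurable
  · exact Eventually.of_forall fun X => by rw [norm_smul, LinearIsometry.norm_map]

theorem eLpNorm_schrodingerFun (lam : ℝ) (X : Heis n) (u : RepSpace n) :
    eLpNorm (schrodingerFun lam X u) 2 volume = ‖u‖ₑ := by
  rw [← eLpNorm_congr_ae (schrodinger_coeFn lam X u), ← Lp.enorm_def, ← ofReal_norm,
    ← ofReal_norm, LinearIsometry.norm_map]

theorem measurable_schrodingerFun_prod {u : (Fin n → ℝ) → ℂ} (hu : Measurable u) (lam : ℝ) :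
    Measurable fun p : Heis n × (Fin n → ℝ) => schrodingerFun lam p.1 u p.2 := by
  have h : Measurable fun p : Heis n × (Fin n → ℝ) => ((lam, p.1), p.2) :=
    (measurable_const.prodMk measurable_fst).prodMk measurable_snd
  have := (measurable_schrodingerFun hu).comp h
  simpa only [Function.comp_def] using this

theorem measurable_schrodingerFun_right {u : (Fin n → ℝ) → ℂ} (hu : Measurable u) (lam : ℝ)
    (X : Heis n) : Measurable (schrodingerFun lam X u) := by
  have := (measurable_schrodingerFun_prod hu lam).comp (measurable_prodMk_left (x := X))
  simpa only [Function.comp_def] using this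

theorem setLIntegral_enorm_le_of_eLpNorm {α : Type*} [MeasurableSpace α] {μ : Measure α}
    {f : α → ℂ} (hf : AEStronglyMeasurable f μ) (s : Set α) :
    ∫⁻ a in s, ‖f a‖ₑ ∂μ ≤ eLpNorm f 2 μ * μ s ^ (1 / 2 : ℝ) := by
  have h1 := eLpNorm_le_eLpNorm_mul_rpow_measure_univ (μ := μ.restrict s)
    (p := 1) (q := 2) (f := f) (by norm_num) hf.restrict
  rw [eLpNorm_one_eq_lintegral_enorm, Measure.restrict_apply_univ] at h1
  have h3 : (1 / (1 : ℝ≥0∞).toReal - 1 / (2 : ℝ≥0∞).toReal) = (1 / 2 : ℝ) := by norm_num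
  rw [h3] at h1
  refine h1.trans ?_
  gcongr
  exact Measure.restrict_le_self

/-- As u is only square integrable, ξ must be confined to a set of finite measure; Cauchy–Schwarz
there gives a bound independent of X, because the representation is isometric. -/
theorem integrable_mul_schrodingerFun {g : Heis n → ℂ} (hg : Integrable g volume) (lam : ℝ)
    (u : RepSpace n) {s : Set (Fin n → ℝ)} (hs : volume s ≠ ⊤) :
    Integrable (fun p : Heis n × (Fin n → ℝ) => g p.1 * schrodingerFun lam p.1 u p.2)
      (volume.prod (volume.restrict s)) := by
  have hm := measurable_schrodingerFun_prod (Lp.stronglyMeasurable u).measurable lam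
  have hm2 : AEStronglyMeasurable (fun p : Heis n × (Fin n → ℝ) =>
      g p.1 * schrodingerFun lam p.1 u p.2) (volume.prod (volume.restrict s)) :=
    hg.1.comp_fst.mul hm.aestronglyMeasurable
  refine ⟨hm2, ?_⟩
  rw [HasFiniteIntegral, lintegral_prod _ hm2.enorm]
  have b (X : Heis n) : ∫⁻ ξ in s, ‖g X * schrodingerFun lam X u ξ‖ₑ ≤
      ‖g X‖ₑ * (‖u‖ₑ * (volume s) ^ (1 / 2 : ℝ)) := by
    simp only [enorm_mul]
    have hmX : Measurable (schrodingerFun lam X u) :=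
      measurable_schrodingerFun_right (Lp.stronglyMeasurable u).measurable lam X
    rw [lintegral_const_mul _ hmX.enorm]
    gcongr
    rw [← eLpNorm_schrodingerFun lam X u]
    exact setLIntegral_enorm_le_of_eLpNorm hmX.aestronglyMeasurable s
  refine (lintegral_mono b).trans_lt ?_
  rw [lintegral_mul_const'' _ hg.1.enorm]
  exact ENNReal.mul_lt_top hg.2 (ENNReal.mul_lt_top enorm_lt_top
    (ENNReal.rpow_lt_top_of_nonneg (by norm_num) hs))

theorem ae_integrable_mul_schrodingerFun {g : Heis n → ℂ} (hg : Integrable g volume) (lam : ℝ)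
    (u : RepSpace n) :
    ∀ᵐ ξ : Fin n → ℝ, Integrable (fun X => g X * schrodingerFun lam X u ξ) volume :=
  ae_of_forall_measure_lt_top_ae_restrict _ fun _ _ hs =>
    (integrable_mul_schrodingerFun hg lam u hs.ne).prod_left_ae

/-- Pairing the vector-valued integral with indicators of sets of finite measure turns it into
scalar integrals, which Fubini identifies. -/
theorem fourierL1_coeFn {g : Heis n → ℂ} (hg : Integrable g volume) (lam : ℝ) (u : RepSpace n) :
    fourierL1 g lam u =ᵐ[volume] fun ξ => ∫ X, g X * schrodingerFun lam X u ξ := by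
  refine ae_eq_of_forall_setIntegral_eq_of_sigmaFinite (fun s _ hs => ?_) (fun s _ hs => ?_)
    fun s hs hs' => ?_
  · exact integrableOn_Lp_of_measure_ne_top _ (by norm_num) hs.ne
  · exact (integrable_mul_schrodingerFun hg lam u hs.ne).integral_prod_right
  · rw [← L2.inner_indicatorConstLp_one (𝕜 := ℂ) hs hs'.ne, fourierL1]
    rw [← integral_inner (integrable_smul_schrodinger hg lam u)]
    rw [← integral_integral_swap (f := fun X ξ => g X * schrodingerFun lam X u ξ)
      (integrable_mul_schrodingerFun hg lam u hs'.ne)]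
    refine integral_congr_ae (Eventually.of_forall fun X => ?_)
    simp only
    rw [inner_smul_right, L2.inner_indicatorConstLp_one, integral_const_mul]
    congr 1
    exact setIntegral_congr_ae hs ((schrodinger_coeFn lam X u).mono fun _ h _ => h)

end Heis

/-! ### Plancherel on ℍⁿ for L¹ ∩ L², through integral kernels. -/

namespace Heis

variable {n : ℕ}

/-- The measure-preserving rearrangement `(y, (x, t)) ↦ (x, y, t)`. -/
noncomputable def rearrange : (Fin n → ℝ) × ((Fin n → ℝ) × ℝ) ≃ᵐ Heis n :=
  (MeasurableEquiv.prodAssoc.symm.trans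
    (MeasurableEquiv.prodComm.prodCongr (MeasurableEquiv.refl ℝ))).trans
      (MeasurableEquiv.prodAssoc : ((Fin n → ℝ) × (Fin n → ℝ)) × ℝ ≃ᵐ _)

theorem rearrange_apply (r : (Fin n → ℝ) × ((Fin n → ℝ) × ℝ)) :
    rearrange r = mk r.2.1 r.1 r.2.2 := rfl

theorem measurePreserving_rearrange : MeasurePreserving (rearrange (n := n)) volume volume :=
  ((volume_preserving_prodAssoc.symm _).trans
    ((Measure.measurePreserving_swap (μ := (volume : Measure (Fin n → ℝ)))
      (ν := (volume : Measure (Fin n → ℝ)))).prod (MeasurePreserving.id (volume : Measure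
          ℝ)))).trans
        volume_preserving_prodAssoc

/-- The Fourier transform in the variables `x` and `t`. -/
noncomputable def partialFourier (g : Heis n → ℂ) (y : Fin n → ℝ) (p : (Fin n → ℝ) × ℝ) : ℂ :=
  ∫ q : (Fin n → ℝ) × ℝ,
    Complex.exp (2 * Real.pi * Complex.I * ((q.2 * p.2 + q.1 ⬝ᵥ p.1 : ℝ) : ℂ)) * g (mk q.1 y q.2)

theorem stronglyMeasurable_partialFourier {g : Heis n → ℂ} (hg : StronglyMeasurable g) :
    StronglyMeasurable fun r : (Fin n → ℝ) × ((Fin n → ℝ) × ℝ) => partialFourier g r.1 r.2 := by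
  refine StronglyMeasurable.integral_prod_right
    (f := fun (r : (Fin n → ℝ) × ((Fin n → ℝ) × ℝ)) (q : (Fin n → ℝ) × ℝ) =>
      Complex.exp (2 * Real.pi * Complex.I * ((q.2 * r.2.2 + q.1 ⬝ᵥ r.2.1 : ℝ) : ℂ)) *
        g (mk q.1 r.1 q.2)) ?_
  refine StronglyMeasurable.mul (Continuous.stronglyMeasurable ?_) ?_
  · simp only [dotProduct]
    fun_prop
  · have h : Measurable fun a : ((Fin n → ℝ) × ((Fin n → ℝ) × ℝ)) × ((Fin n → ℝ) × ℝ) =>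
        (a.1.1, a.2) := by fun_prop
    exact hg.comp_measurable (rearrange.measurable.comp h)

/-- For almost every y the slice of g lies in L¹ ∩ L² of the (x,t)-space, and Euclidean Plancherel
applies to that slice. -/
theorem lintegral_partialFourier_sq {g : Heis n → ℂ} (h1 : Integrable g volume)
    (h2 : MemLp g 2 volume) :
    ∫⁻ y, ∫⁻ p, ‖partialFourier g y p‖ₑ ^ 2 = ∫⁻ X, ‖g X‖ₑ ^ 2 := by
  have i1 := (measurePreserving_rearrange (n := n)).integrable_comp_of_integrable h1
  have i2 := h2.comp_measurePreserving (measurePreserving_rearrange (n := n))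
  rw [← (measurePreserving_rearrange (n := n)).lintegral_comp_emb rearrange.measurableEmbedding]
  have i3 : AEMeasurable (fun r : (Fin n → ℝ) × ((Fin n → ℝ) × ℝ) => ‖g (rearrange r)‖ₑ ^ 2)
      volume :=
    i1.1.enorm.pow_const 2
  have i4 : ∫⁻ r : (Fin n → ℝ) × ((Fin n → ℝ) × ℝ), ‖g (rearrange r)‖ₑ ^ 2 ≠ ⊤ := by
    have := i2.eLpNorm_lt_top
    have e := eLpNorm_two_sq volume (g ∘ rearrange (n := n))
    simp only [Function.comp] at e
    rw [← e]
    exact ENNReal.pow_ne_top this.ne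
  have i5 := lintegral_prod _ i3
  rw [← Measure.volume_eq_prod] at i5
  rw [i5] at i4 ⊢
  refine lintegral_congr_ae ?_
  filter_upwards [i1.prod_right_ae, ae_lt_top' i3.lintegral_prod_right' i4] with y hy1 hy2
  have m2 : MemLp (fun q => (g ∘ rearrange) (y, q)) 2 volume := by
    refine ⟨hy1.1, ?_⟩
    have e := eLpNorm_two_sq volume (fun q => (g ∘ rearrange) (y, q))
    by_contra hc
    rw [not_lt, top_le_iff] at hc
    rw [hc] at e
    simp only [Function.comp_apply] at e
    rw [← e] at hy2
    simp at hy2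
  exact lintegral_enorm_fourier_prod_sq hy1 m2

theorem lintegral_comp_smul_pi (H : (Fin n → ℝ) → ℝ≥0∞) {s : ℝ} (hs : s ≠ 0) :
    ‖s‖ₑ ^ n * ∫⁻ ξ, H (s • ξ) = ∫⁻ a, H a := by
  have h1 : ∫⁻ ξ, H (s • ξ) = ∫⁻ a, H a ∂(Measure.map (s • ·) volume) := by
    have := (MeasurableEquiv.smul₀ s hs : (Fin n → ℝ) ≃ᵐ (Fin n →
        ℝ)).measurableEmbedding.lintegral_map
      (μ := volume) H
    exact this.symm
  rw [h1, Measure.map_addHaar_smul volume hs, lintegral_smul_measure, smul_eq_mul, ← mul_assoc]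
  have : ‖s‖ₑ ^ n * ENNReal.ofReal |(s ^ Module.finrank ℝ (Fin n → ℝ))⁻¹| = 1 := by
    rw [Module.finrank_fin_fun, abs_inv, abs_pow, ← ofReal_norm, Real.norm_eq_abs,
      ← ENNReal.ofReal_pow (abs_nonneg s), ← ENNReal.ofReal_mul (by positivity),
      mul_inv_cancel₀ (by positivity), ENNReal.ofReal_one]
  rw [this, one_mul]

/-- At height s the substitution a = s(ξ + y/2) has Jacobian |s|ⁿ, which is the origin of the
Plancherel density |λ|ⁿ. -/
theorem lintegral_prod_eq_scaled {H : (Fin n → ℝ) × ℝ → ℝ≥0∞} (hH : Measurable H)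
    (y : Fin n → ℝ) :
    ∫⁻ p, H p = ∫⁻ s : ℝ, ‖s‖ₑ ^ n * ∫⁻ ξ, H (s • (ξ + (1 / 2 : ℝ) • y), s) := by
  rw [Measure.volume_eq_prod, lintegral_prod_symm' _ hH]
  have h0 : ∀ᵐ s : ℝ, s ≠ 0 := by simp [ae_iff]
  refine lintegral_congr_ae ?_
  filter_upwards [h0] with s hs
  rw [lintegral_add_right_eq_self (fun ξ => H (s • ξ, s)), lintegral_comp_smul_pi (fun ξ => H (ξ,
      s)) hs]

theorem partialFourier_def (g : Heis n → ℂ) (y : Fin n → ℝ) (p : (Fin n → ℝ) × ℝ) :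
    partialFourier g y p = ∫ q : (Fin n → ℝ) × ℝ,
      Complex.exp (2 * Real.pi * Complex.I * ((q.2 * p.2 + q.1 ⬝ᵥ p.1 : ℝ) : ℂ)) *
        g (mk q.1 y q.2) := rfl

attribute [local irreducible] partialFourier

theorem lintegral_kernel_sq {g : Heis n → ℂ} (hg : StronglyMeasurable g) (h1 : Integrable g volume)
    (h2 : MemLp g 2 volume) :
    ∫⁻ s : ℝ, ‖s‖ₑ ^ n * ∫⁻ ξ, ∫⁻ y, ‖partialFourier g y (s • (ξ + (1 / 2 : ℝ) • y), s)‖ₑ ^ 2 =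
      ∫⁻ X, ‖g X‖ₑ ^ 2 := by
  have hm := (stronglyMeasurable_partialFourier hg).measurable.enorm.pow_const 2
  rw [← lintegral_partialFourier_sq h1 h2]
  have e (y : Fin n → ℝ) : ∫⁻ p, ‖partialFourier g y p‖ₑ ^ 2 = ∫⁻ s : ℝ, ‖s‖ₑ ^ n *
      ∫⁻ ξ, ‖partialFourier g y (s • (ξ + (1 / 2 : ℝ) • y), s)‖ₑ ^ 2 :=
    lintegral_prod_eq_scaled (H := fun p => ‖partialFourier g y p‖ₑ ^ 2)
      (by simpa only [Function.comp_def] using hm.comp (measurable_prodMk_left (x := y))) y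
  simp only [e]
  have hm3 : Measurable fun a : ((Fin n → ℝ) × ℝ) × (Fin n → ℝ) =>
      ‖partialFourier g a.1.1 (a.1.2 • (a.2 + (1 / 2 : ℝ) • a.1.1), a.1.2)‖ₑ ^ 2 := by
    have h : Measurable fun a : ((Fin n → ℝ) × ℝ) × (Fin n → ℝ) =>
      (a.1.1, ((a.1.2 • (a.2 + (1 / 2 : ℝ) • a.1.1), a.1.2) : (Fin n → ℝ) × ℝ)) := by fun_prop
    simpa only [Function.comp_def] using hm.comp h
  rw [lintegral_lintegral_swap]
  · refine lintegral_congr fun s => ?_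
    rw [lintegral_const_mul]
    · congr 1
      rw [lintegral_lintegral_swap]
      have h : Measurable fun a : (Fin n → ℝ) × (Fin n → ℝ) => ((a.2, s), a.1) := by fun_prop
      have := (hm3.comp h).aemeasurable (μ := volume.prod volume)
      simpa only [Function.comp_def, Function.uncurry_def] using this
    · have h : Measurable fun a : (Fin n → ℝ) => (a, s) := by fun_prop
      simpa only [Function.comp_def] using hm3.lintegral_prod_right'.comp h
  · exact ((measurable_snd.enorm.pow_const n).mul hm3.lintegral_prod_right').aemeasurable

/-- The phase s t + s(x·ξ + x·y/2) is the Euclidean pairing of (x,t) with (s(ξ + y/2), s). So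
integrating out x and t leaves an operator whose kernel is the partial Fourier transform. -/
theorem integral_mul_schrodingerFun {g : Heis n → ℂ} (s : ℝ) {u : (Fin n → ℝ) → ℂ} {ξ : Fin n → ℝ}
    (h : Integrable (fun X => g X * schrodingerFun s X u ξ) volume) :
    ∫ X, g X * schrodingerFun s X u ξ =
      ∫ y, partialFourier g y (s • (ξ + (1 / 2 : ℝ) • y), s) * u (ξ + y) := by
  rw [← (measurePreserving_rearrange (n := n)).integral_comp rearrange.measurableEmbedding,
    Measure.volume_eq_prod, integral_prod]
  · refine integral_congr_ae (Eventually.of_forall fun y => ?_)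
    simp only
    rw [partialFourier_def, ← integral_mul_const]
    refine integral_congr_ae (Eventually.of_forall fun q => ?_)
    simp only [rearrange_apply, schrodingerFun, x_mk, y_mk, t_mk]
    rw [← Complex.exp_add]
    have : (2 * Real.pi * Complex.I * s * q.2 + 2 * Real.pi * Complex.I * s *
        ((q.1 ⬝ᵥ ξ + 1 / 2 * q.1 ⬝ᵥ y : ℝ) : ℂ)) = 2 * Real.pi * Complex.I *
        ((q.2 * s + q.1 ⬝ᵥ (s • (ξ + (1 / 2 : ℝ) • y)) : ℝ) : ℂ) := by
      simp only [dotProduct_smul, dotProduct_add, smul_eq_mul]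
      push_cast
      ring
    rw [this]
    ring
  · exact (measurePreserving_rearrange (n := n)).integrable_comp_of_integrable h

/-- Each integral is a coefficient of the conjugate of κ shifted by ξ, so this is Parseval for one
row of the kernel. -/
theorem tsum_enorm_integral_mul_basis_sq {κ : (Fin n → ℝ) → ℂ} (hκ : AEStronglyMeasurable κ volume)
    (h : ∫⁻ y, ‖κ y‖ₑ ^ 2 ≠ ⊤) (ξ : Fin n → ℝ) :
    ∑' i, ‖∫ y, κ y * basis n i (ξ + y)‖ₑ ^ 2 = ∫⁻ y, ‖κ y‖ₑ ^ 2 := by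
  have mp := measurePreserving_add_left (volume : Measure (Fin n → ℝ)) (-ξ)
  have m1 : MemLp κ 2 volume := by
    refine ⟨hκ, ?_⟩
    by_contra hc
    rw [not_lt, top_le_iff] at hc
    exact h (by rw [← eLpNorm_two_sq, hc]; simp)
  have m2 : MemLp (fun η => star (κ (-ξ + η))) 2 volume :=
    (m1.comp_measurePreserving mp).star
  have e1 (i : basisIndex n) : ∫ y, κ y * basis n i (ξ + y) = inner ℂ m2.toLp (basis n i) := by
    rw [L2.inner_def, ← integral_add_left_eq_self _ (-ξ)]
    refine integral_congr_ae ?_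
    filter_upwards [m2.coeFn_toLp] with η hη
    rw [hη]
    simp [mul_comm]
  simp only [e1]
  have e2 : ∫⁻ y, ‖κ y‖ₑ ^ 2 = ‖m2.toLp‖ₑ ^ 2 := by
    rw [Lp.enorm_def, eLpNorm_congr_ae m2.coeFn_toLp, eLpNorm_two_sq]
    have e3 (z : ℂ) : ‖star z‖ₑ = ‖z‖ₑ := by rw [← ofReal_norm, norm_star, ofReal_norm]
    simp only [e3]
    rw [lintegral_add_left_eq_self (fun y => ‖κ y‖ₑ ^ 2)]
  rw [e2]
  have hs := (basis n).hasSum_inner_mul_inner m2.toLp m2.toLp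
  have hs2 : HasSum (fun i => ‖inner ℂ m2.toLp (basis n i)‖ ^ 2) (‖m2.toLp‖ ^ 2) := by
    rw [inner_self_eq_norm_sq_to_K] at hs
    have := Complex.hasSum_re hs
    convert this using 1
    · funext i
      rw [← inner_conj_symm (basis n i) m2.toLp, Complex.mul_conj, Complex.normSq_eq_norm_sq,
        Complex.ofReal_re]
    · norm_cast
  rw [← ofReal_norm, ← ENNReal.ofReal_pow (norm_nonneg _), ← hs2.tsum_eq,
    ENNReal.ofReal_tsum_of_nonneg (fun _ => by positivity) hs2.summable]
  simp only [ENNReal.ofReal_pow (norm_nonneg _), ofReal_norm]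

/-- The sum over the basis is moved inside the ξ-integral, where Parseval holds row by row; the L²
norm of the kernel is then supplied by `lintegral_kernel_sq`. -/
theorem lintegral_tsum_fourierL1_sq {g : Heis n → ℂ} (h1 : Integrable g volume)
    (h2 : MemLp g 2 volume) :
    ∫⁻ lam : ℝ, (∑' i, ‖fourierL1 g lam (basis n i)‖ₑ ^ 2) * ‖lam‖ₑ ^ n = ∫⁻ X, ‖g X‖ₑ ^ 2 := by
  wlog hg : StronglyMeasurable g generalizing g
  · have := this (h1.congr h1.1.ae_eq_mk) (h2.ae_eq h1.1.ae_eq_mk) h1.1.stronglyMeasurable_mk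
    rw [← fourierL1_congr h1.1.ae_eq_mk] at this
    rw [this]
    exact lintegral_congr_ae (h1.1.ae_eq_mk.mono fun X hX => by simp only [hX])
  have fin : ∫⁻ X, ‖g X‖ₑ ^ 2 ≠ ⊤ := by
    rw [← eLpNorm_two_sq]; exact ENNReal.pow_ne_top h2.eLpNorm_lt_top.ne
  have hm3 : StronglyMeasurable fun a : (ℝ × (Fin n → ℝ)) × (Fin n → ℝ) =>
      partialFourier g a.2 (a.1.1 • (a.1.2 + (1 / 2 : ℝ) • a.2), a.1.1) := by
    have h : Measurable fun a : (ℝ × (Fin n → ℝ)) × (Fin n → ℝ) =>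
      (a.2, ((a.1.1 • (a.1.2 + (1 / 2 : ℝ) • a.2), a.1.1) : (Fin n → ℝ) × ℝ)) := by fun_prop
    simpa only [Function.comp_def] using (stronglyMeasurable_partialFourier hg).comp_measurable h
  have hm4 : Measurable fun a : ℝ × (Fin n → ℝ) =>
      ∫⁻ y, ‖partialFourier g y (a.1 • (a.2 + (1 / 2 : ℝ) • y), a.1)‖ₑ ^ 2 :=
    (hm3.measurable.enorm.pow_const 2).lintegral_prod_right'
  have key := lintegral_kernel_sq hg h1 h2
  rw [← key] at fin ⊢
  have hfin := ae_lt_top (((measurable_id.enorm.pow_const n).mul hm4.lintegral_prod_right')) fin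
  have h0 : ∀ᵐ s : ℝ, s ≠ 0 := by simp [ae_iff]
  refine lintegral_congr_ae ?_
  filter_upwards [hfin, h0] with s hs hs0
  rw [mul_comm]
  congr 1
  have hm5 : Measurable fun ξ : Fin n → ℝ =>
      ∫⁻ y, ‖partialFourier g y (s • (ξ + (1 / 2 : ℝ) • y), s)‖ₑ ^ 2 :=
    by simpa only [Function.comp_def] using hm4.comp (measurable_prodMk_left (x := s))
  -- Finiteness of the weighted integrand bounds the kernel only where the weight is nonzero, which
  -- is why s = 0 is discarded.
  have hs2 : ∫⁻ ξ, ∫⁻ y, ‖partialFourier g y (s • (ξ + (1 / 2 : ℝ) • y), s)‖ₑ ^ 2 ≠ ⊤ := by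
    intro hc
    simp only [Pi.mul_apply, id, hc] at hs
    rw [ENNReal.mul_top (by simpa using fun h => absurd h hs0)] at hs
    exact lt_irrefl _ hs
  have hae := ae_lt_top hm5 hs2
  have hint : ∀ᵐ ξ : Fin n → ℝ, ∀ i : basisIndex n,
      Integrable (fun X => g X * schrodingerFun s X (basis n i) ξ) volume :=
    ae_all_iff.mpr fun i => ae_integrable_mul_schrodingerFun h1 s (basis n i)
  calc ∑' i, ‖fourierL1 g s (basis n i)‖ₑ ^ 2
      = ∑' i, ∫⁻ ξ, ‖fourierL1 g s (basis n i) ξ‖ₑ ^ 2 := by simp only [Lp.enorm_sq]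
    _ = ∫⁻ ξ, ∑' i, ‖fourierL1 g s (basis n i) ξ‖ₑ ^ 2 := by
        rw [lintegral_tsum]
        exact fun i => (Lp.aestronglyMeasurable _).enorm.pow_const 2
    _ = _ := by
        refine lintegral_congr_ae ?_
        have hall : ∀ᵐ ξ : Fin n → ℝ, ∀ i : basisIndex n, fourierL1 g s (basis n i) ξ =
            ∫ X, g X * schrodingerFun s X (basis n i) ξ :=
          ae_all_iff.mpr fun i => fourierL1_coeFn h1 s (basis n i)
        filter_upwards [hae, hint, hall] with ξ a1 a2 a3
        simp only [a3]
        have : ∀ i, ∫ X, g X * schrodingerFun s X (basis n i) ξ = _ := fun i =>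
          integral_mul_schrodingerFun s (a2 i)
        simp only [this]
        refine tsum_enorm_integral_mul_basis_sq ?_ a1.ne ξ
        have hh : Measurable fun y : Fin n → ℝ => ((s, ξ), y) := by fun_prop
        have := (hm3.comp_measurable hh).aestronglyMeasurable (μ := volume)
        simpa only [Function.comp_def] using this

end Heis

/-! ### The L² Fourier transform, encoded by the columns of operator fields. -/

theorem tendsto_pow_two_zero_iff {ι : Type*} {l : Filter ι} {f : ι → ℝ≥0∞} :
    Tendsto (fun i => f i ^ 2) l (𝓝 0) ↔ Tendsto f l (𝓝 0) := by
  constructor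
  · intro h
    have := (ENNReal.continuous_rpow_const (y := (1 / 2 : ℝ))).tendsto 0 |>.comp h
    simp only [Function.comp_def, ← ENNReal.rpow_natCast, ← ENNReal.rpow_mul] at this
    simpa using this
  · intro h
    have := (ENNReal.continuous_pow 2).tendsto 0 |>.comp h
    simpa [Function.comp_def] using this

namespace Heis

variable {n : ℕ}

instance : MeasurableSpace (basisIndex n) := ⊤

/-- The measure `|λ|ⁿ dλ`. -/
noncomputable def specMeasure (n : ℕ) : Measure ℝ := volume.withDensity fun lam => ‖lam‖ₑ ^ n

instance : SFinite (specMeasure n) := by unfold specMeasure; infer_instance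

theorem measurable_specDensity : Measurable fun lam : ℝ => ‖lam‖ₑ ^ n :=
  measurable_id.enorm.pow_const n

theorem specMeasure_absolutelyContinuous : specMeasure n ≪ volume :=
  withDensity_absolutelyContinuous _ _

theorem lintegral_specMeasure (f : ℝ → ℝ≥0∞) :
    ∫⁻ lam, f lam ∂(specMeasure n) = ∫⁻ lam, f lam * ‖lam‖ₑ ^ n := by
  rw [specMeasure, lintegral_withDensity_eq_lintegral_mul_non_measurable _ measurable_specDensity
    (Eventually.of_forall fun x => ENNReal.pow_lt_top enorm_lt_top)]
  refine lintegral_congr fun lam => ?_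
  rw [Pi.mul_apply, mul_comm]

/-- The measure on `basisIndex n × ℝ` whose `L²` space models `L²(ℝ*, 𝓑₂; |λ|ⁿ dλ)`. -/
noncomputable def colMeasure (n : ℕ) : Measure (basisIndex n × ℝ) :=
  Measure.count.prod (specMeasure n)

theorem aestronglyMeasurable_colMeasure {h : basisIndex n × ℝ → RepSpace n}
    (H : ∀ i, AEStronglyMeasurable (fun lam => h (i, lam)) (specMeasure n)) :
    AEStronglyMeasurable h (colMeasure n) := by
  rw [colMeasure, Measure.count, Measure.prod_sum_left, aestronglyMeasurable_sum_measure_iff]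
  intro i
  rw [Measure.dirac_prod, (measurableEmbedding_prodMk_left i).aestronglyMeasurable_map_iff]
  exact H i

theorem lintegral_colMeasure {h : basisIndex n × ℝ → RepSpace n}
    (H : AEStronglyMeasurable h (colMeasure n)) :
    ∫⁻ p, ‖h p‖ₑ ^ 2 ∂(colMeasure n) = ∫⁻ lam : ℝ, (∑' i, ‖h (i, lam)‖ₑ ^ 2) * ‖lam‖ₑ ^ n := by
  rw [colMeasure] at H ⊢
  rw [lintegral_prod_symm _ (H.enorm.pow_const 2), ← lintegral_specMeasure]
  simp only [lintegral_count]

/-- The columns `F(λ) eᵢ` of an operator field. -/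
noncomputable def column (F : ℝ → RepSpace n → RepSpace n) (p : basisIndex n × ℝ) : RepSpace n :=
  F p.2 (basis n p.1)

theorem aestronglyMeasurable_column_fourierL1 {g : Heis n → ℂ}
    (hg : AEStronglyMeasurable g volume) :
    AEStronglyMeasurable (column (fourierL1 g)) (colMeasure n) :=
  aestronglyMeasurable_colMeasure fun i =>
    (stronglyMeasurable_fourierL1 hg (basis n i)).aestronglyMeasurable

theorem eLpNorm_column_fourierL1 {g : Heis n → ℂ} (h1 : Integrable g volume)
    (h2 : MemLp g 2 volume) :
    eLpNorm (column (fourierL1 g)) 2 (colMeasure n) = eLpNorm g 2 volume := by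
  refine (ENNReal.pow_right_strictMono two_ne_zero).injective ?_
  rw [eLpNorm_two_sq, eLpNorm_two_sq, ← lintegral_tsum_fourierL1_sq h1 h2,
    lintegral_colMeasure (aestronglyMeasurable_column_fourierL1 h1.1)]
  rfl

theorem memLp_column_fourierL1 {g : Heis n → ℂ} (h1 : Integrable g volume)
    (h2 : MemLp g 2 volume) : MemLp (column (fourierL1 g)) 2 (colMeasure n) :=
  ⟨aestronglyMeasurable_column_fourierL1 h1.1, by
    rw [eLpNorm_column_fourierL1 h1 h2]; exact h2.eLpNorm_lt_top⟩

/-- The subspace `L¹ ∩ L²` of `L²(ℍⁿ)`. -/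
noncomputable def integrableSubmodule (n : ℕ) : Submodule ℂ (L2 n) where
  carrier := {f | Integrable f volume}
  add_mem' {f g} hf hg := (Integrable.add hf hg).congr (Lp.coeFn_add f g).symm
  zero_mem' := (integrable_zero _ _ _).congr (Lp.coeFn_zero ℂ 2 volume).symm
  smul_mem' c f hf := (Integrable.smul c hf).congr (Lp.coeFn_smul c f).symm

theorem fourierL1_add {f g : Heis n → ℂ} (hf : Integrable f volume) (hg : Integrable g volume)
    (lam : ℝ) (u : RepSpace n) :
    fourierL1 (f + g) lam u = fourierL1 f lam u + fourierL1 g lam u := by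
  unfold fourierL1
  rw [← integral_add (integrable_smul_schrodinger hf lam u) (integrable_smul_schrodinger hg lam u)]
  simp only [Pi.add_apply, add_smul]

theorem fourierL1_smul (c : ℂ) (f : Heis n → ℂ) (lam : ℝ) (u : RepSpace n) :
    fourierL1 (c • f) lam u = c • fourierL1 f lam u := by
  unfold fourierL1
  rw [← integral_smul]
  simp only [Pi.smul_apply, smul_assoc]

/-- The Fourier transform on `L¹ ∩ L²` as an isometry. -/
noncomputable def columnIsometry (n : ℕ) :
    integrableSubmodule n →ₗᵢ[ℂ] Lp (RepSpace n) 2 (colMeasure n) where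
  toFun f := (memLp_column_fourierL1 f.2 (Lp.memLp f.1)).toLp
  map_add' f g := by
    rw [← MemLp.toLp_add]
    refine MemLp.toLp_congr _ _ (Eventually.of_forall fun p => ?_)
    have : fourierL1 (↑(f + g).1 : Heis n → ℂ) = fourierL1 ((f.1 : Heis n → ℂ) + (g.1 : Heis n →
        ℂ)) :=
      fourierL1_congr (Lp.coeFn_add f.1 g.1)
    simp only [column, Pi.add_apply]
    rw [this, fourierL1_add f.2 g.2]
  map_smul' c f := by
    rw [RingHom.id_apply, ← MemLp.toLp_const_smul]
    refine MemLp.toLp_congr _ _ (Eventually.of_forall fun p => ?_)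
    have : fourierL1 (↑(c • f).1 : Heis n → ℂ) = fourierL1 (c • (f.1 : Heis n → ℂ)) :=
      fourierL1_congr (Lp.coeFn_smul c f.1)
    simp only [column, Pi.smul_apply]
    rw [this, fourierL1_smul]
  norm_map' f := by
    change ‖(memLp_column_fourierL1 f.2 (Lp.memLp f.1)).toLp‖ = ‖f.1‖
    rw [Lp.norm_toLp, Lp.norm_def, eLpNorm_column_fourierL1 f.2 (Lp.memLp f.1)]

theorem columnIsometry_toLp {f : Heis n → ℂ} (f1 : Integrable f volume) (f2 : MemLp f 2 volume) :
    columnIsometry n ⟨f2.toLp, f1.congr f2.coeFn_toLp.symm⟩ =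
      (memLp_column_fourierL1 f1 f2).toLp := by
  refine MemLp.toLp_congr (memLp_column_fourierL1 (f1.congr f2.coeFn_toLp.symm) (Lp.memLp _)) _
    (Eventually.of_forall fun p => ?_)
  simp only [column]
  rw [fourierL1_congr f2.coeFn_toLp]

theorem inner_column_fourierL1 {g h : Heis n → ℂ} (g1 : Integrable g volume)
    (g2 : MemLp g 2 volume) (h1 : Integrable h volume) (h2 : MemLp h 2 volume) :
    inner ℂ (memLp_column_fourierL1 g1 g2).toLp (memLp_column_fourierL1 h1 h2).toLp =
      inner ℂ g2.toLp h2.toLp := by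
  rw [← columnIsometry_toLp g1 g2, ← columnIsometry_toLp h1 h2, LinearIsometry.inner_map_map,
      Submodule.coe_inner]

theorem IsFourier.aestronglyMeasurable_column {f : Heis n → ℂ}
    {F : ℝ → RepSpace n →L[ℂ] RepSpace n} (hF : IsFourier f F) :
    AEStronglyMeasurable (column fun lam => F lam) (colMeasure n) :=
  aestronglyMeasurable_colMeasure fun i =>
    (aestronglyMeasurable_of_inner (hF.1 (basis n i))).mono_ac specMeasure_absolutelyContinuous

theorem eLpNorm_column_sub_sq {F : ℝ → RepSpace n →L[ℂ] RepSpace n} {g : Heis n → ℂ}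
    (hF : AEStronglyMeasurable (column fun lam => F lam) (colMeasure n))
    (hg : AEStronglyMeasurable g volume) :
    eLpNorm (column (fun lam => F lam) - column (fourierL1 g)) 2 (colMeasure n) ^ 2 =
      ∫⁻ lam : ℝ, hsNormSq (fun u => F lam u - fourierL1 g lam u) * ‖lam‖ₑ ^ n := by
  rw [eLpNorm_two_sq, lintegral_colMeasure (hF.sub (aestronglyMeasurable_column_fourierL1 hg))]
  rfl

/-- The two limits in `IsFourier` are convergence in genuine L² spaces, so inner product identities
on L¹ ∩ L² pass to every version of the transform. -/
theorem IsFourier.exists_tendsto_column {f : Heis n → ℂ} (hf : MemLp f 2 volume)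
    {F : ℝ → RepSpace n →L[ℂ] RepSpace n} (hF : IsFourier f F) :
    ∃ (hm : MemLp (column fun lam => F lam) 2 (colMeasure n)) (g : ℕ → Heis n → ℂ)
      (g1 : ∀ j, Integrable (g j) volume) (g2 : ∀ j, MemLp (g j) 2 volume),
      Tendsto (fun j => (g2 j).toLp) atTop (𝓝 hf.toLp) ∧
      Tendsto (fun j => (memLp_column_fourierL1 (g1 j) (g2 j)).toLp) atTop (𝓝 hm.toLp) := by
  have hmeas := hF.aestronglyMeasurable_column
  obtain ⟨-, g, hg, hgf, hgF⟩ := hF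
  have e (j : ℕ) := eLpNorm_column_sub_sq hmeas (hg j).1.1
  simp only [← e] at hgF
  rw [tendsto_pow_two_zero_iff] at hgF
  have hm : MemLp (column fun lam => F lam) 2 (colMeasure n) := by
    obtain ⟨j, hj⟩ := (hgF.eventually (gt_mem_nhds ENNReal.zero_lt_top)).exists
    have := MemLp.add ⟨hmeas.sub (aestronglyMeasurable_column_fourierL1 (hg j).1.1), hj⟩
      (memLp_column_fourierL1 (hg j).1 (hg j).2)
    simpa using this
  refine ⟨hm, g, fun j => (hg j).1, fun j => (hg j).2, ?_, ?_⟩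
  · rwa [Lp.tendsto_Lp_iff_tendsto_eLpNorm'' g (fun j => (hg j).2)]
  · rw [Lp.tendsto_Lp_iff_tendsto_eLpNorm'' (fun j => column (fourierL1 (g j)))
      (fun j => memLp_column_fourierL1 (hg j).1 (hg j).2)]
    refine hgF.congr fun j => ?_
    rw [← eLpNorm_neg, neg_sub]

theorem IsFourier.memLp_column {f : Heis n → ℂ} (hf : MemLp f 2 volume)
    {F : ℝ → RepSpace n →L[ℂ] RepSpace n} (hF : IsFourier f F) :
    MemLp (column fun lam => F lam) 2 (colMeasure n) :=
  (hF.exists_tendsto_column hf).choose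

theorem IsFourier.inner_column {f h : Heis n → ℂ} (hf : MemLp f 2 volume) (hh : MemLp h 2 volume)
    {F F' : ℝ → RepSpace n →L[ℂ] RepSpace n} (hF : IsFourier f F) (hF' : IsFourier h F') :
    inner ℂ (hF.memLp_column hf).toLp (hF'.memLp_column hh).toLp = inner ℂ hf.toLp hh.toLp := by
  obtain ⟨m, g, g1, g2, t1, t2⟩ := hF.exists_tendsto_column hf
  obtain ⟨m', g', g1', g2', t1', t2'⟩ := hF'.exists_tendsto_column hh
  have a := t1.inner (𝕜 := ℂ) t1'
  have b := t2.inner (𝕜 := ℂ) t2'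
  simp only [inner_column_fourierL1 (g1 _) (g2 _) (g1' _) (g2' _)] at b
  exact tendsto_nhds_unique b a

/-- This is polarized Plancherel. The inner product of columns is split by Fubini into a sum over
the basis, giving `hsInner`, and an integral against |λ|ⁿ dλ. -/
theorem IsFourier.integrable_hsInner {f h : Heis n → ℂ} (hf : MemLp f 2 volume)
    (hh : MemLp h 2 volume) {F F' : ℝ → RepSpace n →L[ℂ] RepSpace n} (hF : IsFourier f F)
    (hF' : IsFourier h F') :
    Integrable (fun lam => hsInner (F lam) (F' lam) * ((|lam| ^ n : ℝ) : ℂ)) volume ∧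
    ∫ lam, hsInner (F lam) (F' lam) * ((|lam| ^ n : ℝ) : ℂ) = inner ℂ hh.toLp hf.toLp := by
  have mF := hF.memLp_column hf
  have mF' := hF'.memLp_column hh
  have hi : Integrable (fun p => inner ℂ (column (fun lam => F' lam) p) (column (fun lam => F lam)
      p))
      (colMeasure n) := by
    refine (L2.integrable_inner (𝕜 := ℂ) mF'.toLp mF.toLp).congr ?_
    filter_upwards [mF.coeFn_toLp, mF'.coeFn_toLp] with p h1 h2
    rw [h1, h2]
  have key := hF'.inner_column hh hf hF
  rw [L2.inner_def] at key
  have e1 : ∫ p, inner ℂ ((mF'.toLp : _ → _) p) ((mF.toLp : _ → _) p) ∂(colMeasure n) =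
      ∫ p, inner ℂ (column (fun lam => F' lam) p) (column (fun lam => F lam) p) ∂(colMeasure n) :=
          by
    refine integral_congr_ae ?_
    filter_upwards [mF.coeFn_toLp, mF'.coeFn_toLp] with p h1 h2
    rw [h1, h2]
  rw [e1] at key
  have hi' := hi
  rw [colMeasure] at hi key
  rw [integral_prod_symm _ hi] at key
  have e2 : ∀ᵐ lam ∂(specMeasure n), ∫ i, inner ℂ (column (fun lam => F' lam) (i, lam))
      (column (fun lam => F lam) (i, lam)) ∂Measure.count = hsInner (F lam) (F' lam) := by
    filter_upwards [hi.prod_left_ae] with lam hl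
    rw [integral_countable hl]
    simp [column, hsInner]
  rw [integral_congr_ae e2] at key
  have hi2 := hi.integral_prod_right.congr e2
  have hlt : ∀ᵐ lam : ℝ, ‖lam‖ₑ ^ n < ⊤ :=
    Eventually.of_forall fun x => ENNReal.pow_lt_top enorm_lt_top
  have e3 (lam : ℝ) : (‖lam‖ₑ ^ n).toReal • hsInner (F lam) (F' lam) =
      hsInner (F lam) (F' lam) * ((|lam| ^ n : ℝ) : ℂ) := by
    rw [ENNReal.toReal_pow, toReal_enorm, Real.norm_eq_abs, Complex.real_smul, mul_comm]
  constructor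
  · have := (integrable_withDensity_iff_integrable_smul' measurable_specDensity hlt).mp hi2
    simpa only [e3] using this
  · rw [← key, specMeasure, integral_withDensity_eq_integral_toReal_smul measurable_specDensity hlt]
    simp only [e3]

end Heis

/-! ### Existence of the transform and its covariance under the centre. -/

namespace Heis

variable {n : ℕ}

/-- By Cauchy–Schwarz, square-summable columns define an operator whose norm is at most its
Hilbert–Schmidt norm. -/
theorem exists_clm_apply_basis {a : basisIndex n → RepSpace n} (ha : ∑' i, ‖a i‖ₑ ^ 2 ≠ ⊤) :
    ∃ T : RepSpace n →L[ℂ] RepSpace n, ∀ i, T (basis n i) = a i := by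
  have hsum : Summable fun i => ‖a i‖ ^ 2 := by
    have := ENNReal.summable_toReal ha
    simpa using this
  have hu (u : RepSpace n) : HasSum (fun i => ‖(basis n).repr u i‖ ^ 2) (‖u‖ ^ 2) := by
    have := lp.hasSum_norm (p := 2) (by norm_num) ((basis n).repr u)
    rw [LinearIsometryEquiv.norm_map] at this
    simpa using this
  have H (u : RepSpace n) := Real.summable_and_inner_le_Lp_mul_Lq_tsum_of_nonneg
    Real.HolderConjugate.two_two (f := fun i => ‖(basis n).repr u i‖) (g := fun i => ‖a i‖)
    (fun _ => norm_nonneg _) (fun _ => norm_nonneg _) (by simpa using (hu u).summable)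
    (by simpa using hsum)
  have Hs (u : RepSpace n) : Summable fun i => (basis n).repr u i • a i := by
    refine Summable.of_norm ?_
    simpa only [norm_smul] using (H u).1
  let T : RepSpace n →ₗ[ℂ] RepSpace n :=
    { toFun := fun u => ∑' i, (basis n).repr u i • a i
      map_add' := fun u v => by
        rw [← (Hs u).tsum_add (Hs v)]
        simp [add_smul]
      map_smul' := fun c u => by
        rw [RingHom.id_apply, ← (Hs u).tsum_const_smul]
        simp [mul_smul] }
  refine ⟨T.mkContinuous ((∑' i, ‖a i‖ ^ (2 : ℝ)) ^ (1 / (2 : ℝ))) fun u => ?_, fun i => ?_⟩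
  · have h1 : ‖T u‖ ≤ ∑' i, ‖(basis n).repr u i‖ * ‖a i‖ := by
      refine (norm_tsum_le_tsum_norm (by simpa only [norm_smul] using (H u).1)).trans_eq ?_
      simp only [norm_smul]
    refine (h1.trans (H u).2).trans_eq ?_
    have : (∑' i, ‖(basis n).repr u i‖ ^ (2 : ℝ)) ^ (1 / (2 : ℝ)) = ‖u‖ := by
      simp only [Real.rpow_two, (hu u).tsum_eq]
      rw [← Real.sqrt_eq_rpow, Real.sqrt_sq (norm_nonneg _)]
    rw [this, mul_comm]
  · change ∑' j, (basis n).repr (basis n i) j • a j = a i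
    classical
    rw [HilbertBasis.repr_self, tsum_eq_single i]
    · simp
    · intro j hj
      simp [hj]

/-- Simple functions approximate f, and isometry makes their columns Cauchy. The limiting columns
are square summable for almost every λ, where they assemble into an operator; elsewhere the operator
is set to 0. This result rules out the default value in the definition of `fourier`. -/
theorem exists_isFourier {f : Heis n → ℂ} (hf : MemLp f 2 volume) :
    ∃ F : ℝ → RepSpace n →L[ℂ] RepSpace n, IsFourier f F := by
  have hap (j : ℕ) : ∃ g : Heis n → ℂ, Integrable g volume ∧ MemLp g 2 volume ∧
      eLpNorm (g - f) 2 volume < ((j : ℝ≥0∞) + 1)⁻¹ := by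
    obtain ⟨g, hg, hg2⟩ := hf.exists_simpleFunc_eLpNorm_sub_lt (by norm_num)
      (ε := ((j : ℝ≥0∞) + 1)⁻¹) (by simp)
    refine ⟨g, (SimpleFunc.memLp_iff_integrable (by norm_num) (by norm_num)).mp hg2, hg2, ?_⟩
    rwa [← eLpNorm_neg, neg_sub]
  choose g g1 g2 g3 using hap
  have t1 : Tendsto (fun j => eLpNorm (g j - f) 2 volume) atTop (𝓝 0) := by
    refine tendsto_of_tendsto_of_tendsto_of_le_of_le tendsto_const_nhds
      (h := fun j : ℕ => ((j : ℝ≥0∞) + 1)⁻¹) ?_ (fun _ => zero_le) fun j => (g3 j).le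
    have := (tendsto_add_atTop_iff_nat 1).mpr ENNReal.tendsto_inv_nat_nhds_zero
    simpa using this
  have t2 := (Lp.tendsto_Lp_iff_tendsto_eLpNorm'' g g2 f hf).mpr t1
  have e (j : ℕ) : columnIsometry n ⟨(g2 j).toLp, (g1 j).congr (g2 j).coeFn_toLp.symm⟩ =
      (memLp_column_fourierL1 (g1 j) (g2 j)).toLp := columnIsometry_toLp (g1 j) (g2 j)
  have c1 : CauchySeq fun j => (memLp_column_fourierL1 (g1 j) (g2 j)).toLp := by
    have := t2.cauchySeq
    rw [Metric.cauchySeq_iff] at this ⊢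
    simpa only [← e, LinearIsometry.dist_map, Subtype.dist_eq] using this
  obtain ⟨c, hc⟩ := cauchySeq_tendsto_of_complete c1
  have hcm : Measurable fun lam : ℝ => ∑' i, ‖c (i, lam)‖ₑ ^ 2 :=
    Measurable.tsum fun i => ((Lp.stronglyMeasurable c).comp_measurable
      measurable_prodMk_left).enorm.pow_const 2
  have hfin : ∀ᵐ lam ∂(specMeasure n), ∑' i, ‖c (i, lam)‖ₑ ^ 2 ≠ ⊤ := by
    have h1 : ∫⁻ lam, ∑' i, ‖c (i, lam)‖ₑ ^ 2 ∂(specMeasure n) ≠ ⊤ := by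
      rw [lintegral_specMeasure, ← lintegral_colMeasure (Lp.aestronglyMeasurable c), ← Lp.enorm_sq]
      exact ENNReal.pow_ne_top enorm_ne_top
    exact (ae_lt_top hcm h1).mono fun _ h => h.ne
  have hex (lam : ℝ) : ∃ T : RepSpace n →L[ℂ] RepSpace n, ∀ i, T (basis n i) =
      if ∑' i, ‖c (i, lam)‖ₑ ^ 2 ≠ ⊤ then c (i, lam) else 0 := by
    by_cases h : ∑' i, ‖c (i, lam)‖ₑ ^ 2 ≠ ⊤
    · simp only [if_pos h]
      exact exists_clm_apply_basis h
    · exact ⟨0, fun i => by simp [h]⟩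
  choose F hF using hex
  have hFm (i : basisIndex n) : StronglyMeasurable fun lam => F lam (basis n i) := by
    simp only [hF]
    refine StronglyMeasurable.ite ?_ ?_ stronglyMeasurable_const
    · exact (measurableSet_eq_fun hcm measurable_const).compl
    · exact (Lp.stronglyMeasurable c).comp_measurable measurable_prodMk_left
  have hFm2 (u : RepSpace n) : StronglyMeasurable fun lam => F lam u := by
    refine stronglyMeasurable_of_tendsto (atTop : Filter (Finset (basisIndex n)))
      (f := fun s lam => ∑ i ∈ s, (basis n).repr u i • F lam (basis n i)) (fun s => ?_) ?_
    · refine Finset.stronglyMeasurable_fun_sum _ fun i _ => ?_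
      exact (hFm i).const_smul ((basis n).repr u i)
    · refine tendsto_pi_nhds.mpr fun lam => ?_
      have := (F lam).hasSum ((basis n).hasSum_repr u)
      simp only [map_smul] at this
      exact this
  have hcol : (column fun lam => F lam) =ᵐ[colMeasure n] c := by
    have : ∀ᵐ p ∂(colMeasure n), ∑' i, ‖c (i, p.2)‖ₑ ^ 2 ≠ ⊤ :=
      Measure.quasiMeasurePreserving_snd.ae hfin
    filter_upwards [this] with p hp
    simp only [column, hF, if_pos hp]
  refine ⟨F, fun u v => ?_, g, fun j => ⟨g1 j, g2 j⟩, t1, ?_⟩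
  · exact (stronglyMeasurable_const.inner (hFm2 u)).measurable.aemeasurable
  · have m : MemLp (column fun lam => F lam) 2 (colMeasure n) := (Lp.memLp c).ae_eq hcol.symm
    simp only [← eLpNorm_column_sub_sq m.1 (g1 _).1]
    rw [tendsto_pow_two_zero_iff]
    have e2 : m.toLp = c := by
      refine Lp.ext (m.coeFn_toLp.trans hcol)
    rw [← e2, Lp.tendsto_Lp_iff_tendsto_eLpNorm'' (fun j => column (fourierL1 (g j)))
      (fun j => memLp_column_fourierL1 (g1 j) (g2 j))] at hc
    refine hc.congr fun j => ?_
    rw [← eLpNorm_neg, neg_sub]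

theorem isFourier_fourier {f : Heis n → ℂ} (hf : MemLp f 2 volume) : IsFourier f (fourier f) := by
  rw [fourier, dif_pos (exists_isFourier hf)]
  exact (exists_isFourier hf).choose_spec

theorem schrodinger_central_mul (lam τ : ℝ) (X : Heis n) (u : RepSpace n) :
    schrodinger lam (mk 0 0 τ * X) u =
      Complex.exp (2 * Real.pi * Complex.I * lam * τ) • schrodinger lam X u := by
  refine Lp.ext ?_
  filter_upwards [schrodinger_coeFn lam (mk 0 0 τ * X) u, schrodinger_coeFn lam X u,
    Lp.coeFn_smul (Complex.exp (2 * Real.pi * Complex.I * lam * τ)) (schrodinger lam X u)]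
    with ξ h1 h2 h3
  rw [h1, h3, Pi.smul_apply, h2, smul_eq_mul]
  simp only [schrodingerFun, t_mul, x_mul, y_mul, x_mk, y_mk, t_mk, zero_add, dotProduct_zero,
    sub_zero, mul_zero, add_zero]
  push_cast
  rw [mul_add, Complex.exp_add]
  ring

theorem measurableEmbedding_mul_left (a : Heis n) : MeasurableEmbedding fun X : Heis n => a * X :=
  MeasurableEquiv.measurableEmbedding
    { toEquiv := Equiv.mulLeft a
      measurable_toFun := (measurePreserving_mul_left a).measurable
      measurable_invFun := (measurePreserving_mul_left a⁻¹).measurable }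

theorem fourierL1_leftTranslate_central (g : Heis n → ℂ) (lam τ : ℝ) (u : RepSpace n) :
    fourierL1 (leftTranslate (mk 0 0 τ) g) lam u =
      Complex.exp (2 * Real.pi * Complex.I * lam * τ) • fourierL1 g lam u := by
  unfold fourierL1
  have hmp := measurePreserving_mul_left (mk 0 0 τ : Heis n)
  rw [← hmp.integral_comp (measurableEmbedding_mul_left _), ← integral_smul]
  refine integral_congr_ae (Eventually.of_forall fun X => ?_)
  simp only [leftTranslate, inv_mul_cancel_left, schrodinger_central_mul]
  rw [smul_comm]

/-- The centre acts by unimodular scalars, so the same factor multiplies the approximants and their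
limit, and Hilbert–Schmidt distances do not change. -/
theorem IsFourier.leftTranslate_central {f : Heis n → ℂ} (hf : MemLp f 2 volume)
    {F : ℝ → RepSpace n →L[ℂ] RepSpace n} (hF : IsFourier f F) (τ : ℝ) :
    IsFourier (leftTranslate (mk 0 0 τ) f)
      (fun lam => Complex.exp (2 * Real.pi * Complex.I * lam * τ) • F lam) := by
  obtain ⟨hm, g, hg, t1, t2⟩ := hF
  have hmp := measurePreserving_mul_left (mk 0 0 τ : Heis n)⁻¹
  refine ⟨fun u v => ?_, fun j => leftTranslate (mk 0 0 τ) (g j),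
    fun j => ⟨hmp.integrable_comp_of_integrable (hg j).1, memLp_leftTranslate _ (hg j).2⟩, ?_, ?_⟩
  · simp only [_root_.smul_apply, inner_smul_right]
    refine AEMeasurable.mul (Continuous.aemeasurable ?_) (hm u v)
    fun_prop
  · refine t1.congr fun j => ?_
    exact (eLpNorm_comp_measurePreserving ((hg j).1.1.sub hf.1) hmp).symm
  · refine t2.congr fun j => lintegral_congr fun lam => ?_
    congr 1
    refine tsum_congr fun i => ?_
    simp only [fourierL1_leftTranslate_central, _root_.smul_apply]
    rw [← smul_sub, enorm_smul]
    have h : ‖Complex.exp (2 * Real.pi * Complex.I * lam * τ)‖ₑ = 1 := by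
      rw [← ofReal_norm, ← ENNReal.ofReal_one, ← Complex.norm_exp_ofReal_mul_I (2 * Real.pi * lam
          * τ)]
      congr 3
      push_cast
      ring
    rw [h, one_mul]

end Heis

/-! ### Periodization and uniqueness of Fourier coefficients on the circle. -/

theorem MeasureTheory.ae_summable_of_summable_integral_norm {α ι : Type*} [MeasurableSpace α]
    [Countable ι] {μ : Measure α} {F : ι → α → ℂ} (hF : ∀ i, Integrable (F i) μ)
    (hs : Summable fun i => ∫ a, ‖F i a‖ ∂μ) :
    (∑' i, ∫⁻ a, ‖F i a‖ₑ ∂μ ≠ ⊤) ∧ ∀ᵐ a ∂μ, Summable fun i => F i a := by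
  have h1 : ∑' i, ∫⁻ a, ‖F i a‖ₑ ∂μ ≠ ⊤ := by
    have e (i : ι) : ∫⁻ a, ‖F i a‖ₑ ∂μ = ENNReal.ofReal (∫ a, ‖F i a‖ ∂μ) := by
      rw [ofReal_integral_norm_eq_lintegral_enorm (hF i)]
    simp only [e]
    rw [← ENNReal.ofReal_tsum_of_nonneg (fun i => integral_nonneg fun _ => norm_nonneg _) hs]
    exact ENNReal.ofReal_ne_top
  refine ⟨h1, ?_⟩
  have h2 := h1
  rw [← lintegral_tsum fun i => (hF i).1.enorm] at h2
  filter_upwards [ae_lt_top' (AEMeasurable.tsum fun i => (hF i).1.enorm) h2] with a ha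
  refine Summable.of_norm ?_
  have := ENNReal.summable_toReal ha.ne
  simpa using this

theorem MeasureTheory.integrable_tsum_of_summable_integral_norm {α ι : Type*} [MeasurableSpace α]
    [Countable ι] {μ : Measure α} {F : ι → α → ℂ} (hF : ∀ i, Integrable (F i) μ)
    (hs : Summable fun i => ∫ a, ‖F i a‖ ∂μ) : Integrable (fun a => ∑' i, F i a) μ := by
  obtain ⟨h1, h2⟩ := ae_summable_of_summable_integral_norm hF hs
  refine ⟨?_, ?_⟩
  · refine aestronglyMeasurable_of_tendsto_ae (atTop : Filter (Finset ι))
      (f := fun s a => ∑ i ∈ s, F i a)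
      (fun s => Finset.aestronglyMeasurable_fun_sum _ fun i _ => (hF i).1) ?_
    filter_upwards [h2] with a ha
    exact ha.hasSum
  · refine (lintegral_mono fun a => enorm_tsum_le_tsum_enorm).trans_lt ?_
    rw [lintegral_tsum fun i => (hF i).1.enorm]
    exact h1.lt_top

/-- The representative in `(0, 1]` of a point of the circle. -/
noncomputable def circleRep (z : AddCircle (1 : ℝ)) : ℝ := AddCircle.equivIoc 1 0 z

theorem coe_circleRep (z : AddCircle (1 : ℝ)) : (circleRep z : AddCircle (1 : ℝ)) = z :=
  AddCircle.coe_equivIoc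

theorem haarAddCircle_eq_volume :
    (AddCircle.haarAddCircle (T := (1 : ℝ))) = (volume : Measure (AddCircle (1 : ℝ))) := by
  rw [AddCircle.volume_eq_smul_haarAddCircle]
  simp

theorem measurePreserving_circleRep :
    MeasurePreserving circleRep AddCircle.haarAddCircle (volume.restrict (Set.Ioc (0 : ℝ) 1)) := by
  rw [haarAddCircle_eq_volume]
  have h := AddCircle.measurePreserving_equivIoc (T := (1 : ℝ)) (a := 0)
  have h2 := measurePreserving_subtype_coe (μa := (volume : Measure ℝ))
    (measurableSet_Ioc (a := (0 : ℝ)) (b := 0 + 1))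
  have h3 : MeasurePreserving circleRep volume (volume.restrict (Set.Ioc (0 : ℝ) (0 + 1))) :=
    h2.comp h
  rwa [zero_add] at h3

theorem ae_circle_of_ae_real {p : ℝ → Prop} (h : ∀ᵐ lam ∂(volume.restrict (Set.Ioc (0 : ℝ) 1)), p
    lam) :
    ∀ᵐ z ∂(AddCircle.haarAddCircle (T := (1 : ℝ))), p (circleRep z) :=
  measurePreserving_circleRep.quasiMeasurePreserving.ae h

theorem ae_real_of_ae_circle {p : AddCircle (1 : ℝ) → Prop}
    (h : ∀ᵐ z ∂(AddCircle.haarAddCircle (T := (1 : ℝ))), p z) :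
    ∀ᵐ lam : ℝ ∂(volume.restrict (Set.Ioc (0 : ℝ) 1)), p (lam : AddCircle (1 : ℝ)) := by
  rw [haarAddCircle_eq_volume] at h
  have := AddCircle.measurePreserving_mk 1 0
  rw [zero_add] at this
  exact this.quasiMeasurePreserving.ae h

/-- The periodization `∑_r H(λ + r)` as a function on the circle. -/
noncomputable def periodization (H : ℝ → ℂ) (z : AddCircle (1 : ℝ)) : ℂ :=
  ∑' r : ℤ, H (circleRep z + r)

theorem periodization_coe (H : ℝ → ℂ) (lam : ℝ) :
    periodization H (lam : AddCircle (1 : ℝ)) = ∑' r : ℤ, H (lam + r) := by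
  have h : (circleRep (lam : AddCircle (1 : ℝ)) : AddCircle (1 : ℝ)) = lam := coe_circleRep _
  obtain ⟨k, hk⟩ := AddSubgroup.mem_zmultiples_iff.mp (QuotientAddGroup.eq_iff_sub_mem.mp h)
  have hk' : circleRep (lam : AddCircle (1 : ℝ)) = lam + k := by
    rw [zsmul_one] at hk
    linarith
  rw [periodization, hk', ← (Equiv.addLeft k).tsum_eq fun r : ℤ => H (lam + r)]
  refine tsum_congr fun r => ?_
  rw [Equiv.coe_addLeft]
  push_cast
  rw [add_assoc]

theorem integrable_comp_add_int {H : ℝ → ℂ} (hH : Integrable H) :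
    (∀ r : ℤ, Integrable (fun x => H (x + r)) (volume.restrict (Set.Ioc (0 : ℝ) 1))) ∧
    Summable fun r : ℤ => ∫ x in Set.Ioc (0 : ℝ) 1, ‖H (x + r)‖ := by
  refine ⟨fun r => (hH.comp_add_right (r : ℝ)).restrict, ?_⟩
  have := hH.norm.hasSum_intervalIntegral_comp_add_int.summable
  simpa only [intervalIntegral.integral_of_le zero_le_one] using this

theorem integrable_periodization {H : ℝ → ℂ} (hH : Integrable H) :
    Integrable (periodization H) AddCircle.haarAddCircle := by
  have h := integrable_tsum_of_summable_integral_norm (integrable_comp_add_int hH).1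
    (integrable_comp_add_int hH).2
  have := measurePreserving_circleRep.integrable_comp_of_integrable h
  exact this

/-- The characters are invariant under integer shifts, so the integral over one period of the sum
unfolds to an integral over the line. -/
theorem fourierCoeff_periodization {H : ℝ → ℂ} (hH : Integrable H) (m : ℤ) :
    fourierCoeff (periodization H) m =
      ∫ lam, H lam * Complex.exp (-(2 * Real.pi * Complex.I * lam * m)) := by
  have h1 (lam : ℝ) : ‖Complex.exp (-(2 * Real.pi * Complex.I * lam * m))‖ = 1 := by
    rw [← Complex.norm_exp_ofReal_mul_I (-(2 * Real.pi * lam * m))]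
    congr 2; push_cast; ring
  have hi : Integrable fun lam : ℝ => H lam * Complex.exp (-(2 * Real.pi * Complex.I * lam * m)) :=
    hH.mul_bdd (c := 1) (Continuous.aestronglyMeasurable (by fun_prop))
      (Eventually.of_forall fun lam => (h1 lam).le)
  rw [fourierCoeff_eq_intervalIntegral _ m 0, ← hi.hasSum_intervalIntegral_comp_add_int.tsum_eq]
  simp only [zero_add, intervalIntegral.integral_of_le zero_le_one, div_one, one_smul]
  rw [integral_tsum_of_summable_integral_norm (integrable_comp_add_int hi).1
    (integrable_comp_add_int hi).2]
  refine integral_congr_ae (Eventually.of_forall fun lam => ?_)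
  simp only [periodization_coe, smul_eq_mul]
  rw [← tsum_mul_left]
  refine tsum_congr fun r => ?_
  rw [mul_comm]
  congr 1
  rw [fourier_coe_apply]
  rw [Complex.exp_eq_exp_iff_exists_int]
  exact ⟨r * m, by push_cast; ring⟩

/-- For merely integrable f the Hilbert basis is not available. Instead, g ↦ ∫ g f is bounded on
continuous functions and vanishes on characters, hence everywhere; indicators of closed sets are
bounded limits of continuous functions. -/
theorem MeasureTheory.Integrable.ae_eq_zero_of_fourierCoeff_eq_zero {f : AddCircle (1 : ℝ) → ℂ}
    (hf : Integrable f AddCircle.haarAddCircle) (h : ∀ m, fourierCoeff f m = 0) :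
    f =ᵐ[AddCircle.haarAddCircle] 0 := by
  have hmul (g : C(AddCircle (1 : ℝ), ℂ)) : Integrable (fun z => g z * f z)
      AddCircle.haarAddCircle :=
    hf.bdd_mul g.continuous.aestronglyMeasurable
      (Eventually.of_forall fun z => g.norm_coe_le_norm z)
  let T : C(AddCircle (1 : ℝ), ℂ) →ₗ[ℂ] ℂ :=
    { toFun := fun g => ∫ z, g z * f z ∂AddCircle.haarAddCircle
      map_add' := fun a b => by
        rw [← integral_add (hmul a) (hmul b)]
        simp only [ContinuousMap.add_apply, add_mul]
      map_smul' := fun c a => by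
        rw [RingHom.id_apply, smul_eq_mul, ← integral_const_mul]
        simp only [ContinuousMap.smul_apply, smul_eq_mul, mul_assoc] }
  have hT : ∀ g, ‖T g‖ ≤ (∫ z, ‖f z‖ ∂AddCircle.haarAddCircle) * ‖g‖ := fun g => by
    rw [← integral_mul_const]
    refine norm_integral_le_of_norm_le (hf.norm.mul_const _) (Eventually.of_forall fun z => ?_)
    rw [norm_mul, mul_comm]
    exact mul_le_mul_of_nonneg_left (g.norm_coe_le_norm z) (norm_nonneg _)
  have hz : ∀ g : C(AddCircle (1 : ℝ), ℂ), T.mkContinuous _ hT g = 0 := by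
    have hk : Submodule.span ℂ (Set.range (fourier (T := (1 : ℝ)))) ≤
        LinearMap.ker (T.mkContinuous _ hT).toLinearMap := by
      rw [Submodule.span_le]
      rintro _ ⟨m, rfl⟩
      have := h (-m)
      rw [fourierCoeff, neg_neg] at this
      exact this
    have hk2 := Submodule.topologicalClosure_minimal _ hk (T.mkContinuous _ hT).isClosed_ker
    rw [span_fourier_closure_eq_top] at hk2
    exact fun g => hk2 (Submodule.mem_top (x := g))
  refine ae_eq_zero_of_forall_setIntegral_isClosed_eq_zero hf fun s hs => ?_
  rw [← integral_indicator hs.measurableSet]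
  have lim : Tendsto (fun j => ∫ z, ((hs.apprSeq j z : ℝ) : ℂ) * f z ∂AddCircle.haarAddCircle)
      atTop (𝓝 (∫ z, s.indicator f z ∂AddCircle.haarAddCircle)) := by
    refine tendsto_integral_of_dominated_convergence (fun z => ‖f z‖) (fun j => ?_) hf.norm
      (fun j => Eventually.of_forall fun z => ?_) (Eventually.of_forall fun z => ?_)
    · refine AEStronglyMeasurable.mul (Continuous.aestronglyMeasurable ?_) hf.1
      have := (hs.apprSeq j).continuous
      fun_prop
    · rw [norm_mul]
      refine mul_le_of_le_one_left (norm_nonneg _) ?_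
      have := HasOuterApproxClosed.apprSeq_apply_le_one hs j z
      simpa using this
    · have := (tendsto_pi_nhds.mp (HasOuterApproxClosed.tendsto_apprSeq hs)) z
      have h2 : Tendsto (fun j => ((hs.apprSeq j z : ℝ) : ℂ)) atTop
          (𝓝 (((s.indicator (fun _ => (1 : NNReal)) z : NNReal) : ℝ) : ℂ)) :=
        ((Complex.continuous_ofReal.comp NNReal.continuous_coe).tendsto _).comp this
      have h3 := h2.mul_const (f z)
      convert h3 using 2
      by_cases hzs : z ∈ s <;> simp [hzs]
  refine tendsto_nhds_unique lim ?_
  have e (j : ℕ) : ∫ z, ((hs.apprSeq j z : ℝ) : ℂ) * f z ∂AddCircle.haarAddCircle = 0 :=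
    hz ⟨fun z => ((hs.apprSeq j z : ℝ) : ℂ), by
      have := (hs.apprSeq j).continuous
      fun_prop⟩
  simp only [e]
  exact tendsto_const_nhds

/-! ### Fourier coefficients of G and the meaning of Condition C. -/

namespace Heis

variable {n : ℕ}

theorem lat_eq_central_mul (k l : Fin n → ℤ) (m : ℤ) :
    lat k l m = mk 0 0 (m : ℝ) * lat k l 0 := by
  ext i <;> simp [lat]

theorem lat_eq_mul_central (k l : Fin n → ℤ) (m : ℤ) :
    lat k l m = lat k l 0 * mk 0 0 (m : ℝ) := by
  ext i <;> simp [lat]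

theorem leftTranslate_mul (a b : Heis n) (f : Heis n → ℂ) :
    leftTranslate (a * b) f = leftTranslate a (leftTranslate b f) := by
  funext X
  simp only [leftTranslate, mul_inv_rev, mul_assoc]

theorem leftTranslate_one (f : Heis n → ℂ) : leftTranslate 1 f = f := by
  funext X
  simp [leftTranslate]

theorem lat_zero : lat (0 : Fin n → ℤ) 0 0 = 1 := by
  ext i <;> simp [lat]

/-- The summand of `G`, whose periodization is `G`. -/
noncomputable def specDensity (φ : Heis n → ℂ) (k l : Fin n → ℤ) (lam : ℝ) : ℂ :=
  hsInner (fourier φ lam) (fourier (leftTranslate (lat k l 0) φ) lam) * ((|lam| ^ n : ℝ) : ℂ)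

theorem G_eq_periodization (φ : Heis n → ℂ) (k l : Fin n → ℤ) (lam : ℝ) :
    G φ k l lam = periodization (specDensity φ k l) (lam : AddCircle (1 : ℝ)) := by
  rw [periodization_coe]
  rfl

variable {φ : Heis n → ℂ}

theorem integrable_specDensity (hφ : MemLp φ 2 volume) (k l : Fin n → ℤ) :
    Integrable (specDensity φ k l) volume :=
  ((isFourier_fourier hφ).integrable_hsInner hφ (memLp_leftTranslate _ hφ)
    (isFourier_fourier (memLp_leftTranslate _ hφ))).1

theorem hsInner_smul_right (S T : RepSpace n →L[ℂ] RepSpace n) (c : ℂ) :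
    hsInner S (c • T) = star c * hsInner S T := by
  unfold hsInner
  rw [← tsum_mul_left]
  refine tsum_congr fun i => ?_
  rw [_root_.smul_apply, inner_smul_left]
  rfl

theorem fourierCoeff_specDensity (hφ : MemLp φ 2 volume) (k l : Fin n → ℤ) (m : ℤ) :
    fourierCoeff (periodization (specDensity φ k l)) m =
      inner ℂ (latticeTranslates hφ (k, l, m)) hφ.toLp := by
  rw [fourierCoeff_periodization (integrable_specDensity hφ k l)]
  have h1 := memLp_leftTranslate (lat k l 0) hφ
  -- Plancherel accepts any version of the transform. This one differs from the factor in
  -- `specDensity` by a character, which becomes the character of the Fourier coefficient.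
  have h2 := (isFourier_fourier h1).leftTranslate_central h1 (m : ℝ)
  rw [← leftTranslate_mul, ← lat_eq_central_mul] at h2
  have h3 := ((isFourier_fourier hφ).integrable_hsInner hφ (memLp_leftTranslate _ hφ) h2).2
  simp only [latticeTranslates]
  rw [← h3]
  refine integral_congr_ae (Eventually.of_forall fun lam => ?_)
  simp only [hsInner_smul_right, specDensity]
  have e : star (Complex.exp (2 * Real.pi * Complex.I * lam * ((m : ℝ) : ℂ))) =
      Complex.exp (-(2 * Real.pi * Complex.I * lam * m)) := by
    rw [Complex.star_def, ← Complex.exp_conj]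
    congr 1
    simp [map_ofNat]
  rw [e]
  ring

/-- G_{k,l} is the periodization of an integrable function, so it vanishes almost everywhere exactly
when its Fourier coefficients do. -/
theorem conditionC_iff (hφ : MemLp φ 2 volume) :
    ConditionC φ ↔ ∀ k l : Fin n → ℤ, (k, l) ≠ (0, 0) → ∀ m,
      inner ℂ (latticeTranslates hφ (k, l, m)) hφ.toLp = 0 := by
  refine forall_congr' fun k => forall_congr' fun l => forall_congr' fun _ => ?_
  simp only [G_eq_periodization, ← fourierCoeff_specDensity]
  constructor
  · intro h m
    have h1 := ae_circle_of_ae_real h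
    simp only [coe_circleRep] at h1
    have h2 : fourierCoeff (periodization (specDensity φ k l)) m =
        fourierCoeff (0 : AddCircle (1 : ℝ) → ℂ) m := by
      rw [fourierCoeff_congr_ae h1]
      rfl
    rw [h2]
    simp [fourierCoeff]
  · intro h
    exact ae_real_of_ae_circle ((integrable_periodization
      (integrable_specDensity hφ k l)).ae_eq_zero_of_fourierCoeff_eq_zero h)

/-- The function `G_{0,0}` on the circle, as a real function. -/
noncomputable def weight (φ : Heis n → ℂ) (z : AddCircle (1 : ℝ)) : ℝ :=
  (periodization (specDensity φ 0 0) z).re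

/-- At (k,l) = (0,0) the pairing is a sum of squared norms. Reality and positivity hold at every
point, whatever the convergence of the sums, so Ω_φ is exactly where `weight` is nonzero. -/
theorem periodization_eq_weight (φ : Heis n → ℂ) (z : AddCircle (1 : ℝ)) :
    0 ≤ weight φ z ∧ periodization (specDensity φ 0 0) z = (weight φ z : ℂ) := by
  have h (lam : ℝ) : specDensity φ 0 0 lam =
      (((∑' i, ‖fourier φ lam (basis n i)‖ ^ 2) * |lam| ^ n : ℝ) : ℂ) := by
    rw [specDensity, lat_zero, leftTranslate_one, hsInner, Complex.ofReal_mul, Complex.ofReal_tsum]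
    congr 1
    refine tsum_congr fun i => ?_
    rw [inner_self_eq_norm_sq_to_K]
    norm_cast
  have h2 : periodization (specDensity φ 0 0) z = ((∑' r : ℤ,
      (∑' i, ‖fourier φ (circleRep z + r) (basis n i)‖ ^ 2) * |circleRep z + r| ^ n : ℝ) : ℂ) := by
    rw [periodization, Complex.ofReal_tsum]
    exact tsum_congr fun r => h _
  rw [weight, h2, Complex.ofReal_re]
  exact ⟨tsum_nonneg fun r => mul_nonneg (tsum_nonneg fun i => by positivity) (by positivity), rfl⟩

theorem integrable_weight (hφ : MemLp φ 2 volume) :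
    Integrable (weight φ) AddCircle.haarAddCircle :=
  (integrable_periodization (integrable_specDensity hφ 0 0)).re

theorem fourierCoeff_weight (hφ : MemLp φ 2 volume) (m : ℤ) :
    fourierCoeff (fun z => (weight φ z : ℂ)) m =
      inner ℂ (latticeTranslates hφ (0, 0, m)) hφ.toLp := by
  rw [← fourierCoeff_specDensity hφ 0 0 m]
  congr 1
  funext z
  exact (periodization_eq_weight φ z).2.symm

theorem mem_Omega_iff (lam : ℝ) :
    lam ∈ Omega φ ↔ 0 < weight φ (lam : AddCircle (1 : ℝ)) := by
  rw [Omega, Set.mem_ofPred_eq, G_eq_periodization]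
  rfl

end Heis

/-! ### Bessel families, frame expansions and ℓ² synthesis. -/

section

open scoped lp

section Bessel

variable {E ι : Type*} [NormedAddCommGroup E] [InnerProductSpace ℂ E]

theorem memℓp_two_iff_tsum_enorm {c : ι → ℂ} : Memℓp c 2 ↔ ∑' i, ‖c i‖ₑ ^ 2 ≠ ⊤ := by
  rw [memℓp_gen_iff (by norm_num)]
  have e (i : ι) : ‖c i‖ₑ ^ 2 = ((‖c i‖₊ ^ 2 : NNReal) : ℝ≥0∞) := by simp [enorm]
  simp only [e]
  rw [ENNReal.tsum_coe_ne_top_iff_summable, ← NNReal.summable_coe]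
  simp

theorem lp_two_enorm_sq (c : ℓ²(ι, ℂ)) : ‖c‖ₑ ^ 2 = ∑' i, ‖c i‖ₑ ^ 2 := by
  have h := lp.hasSum_norm (p := 2) (by norm_num) c
  have h2 : HasSum (fun i => ‖c i‖ ^ 2) (‖c‖ ^ 2) := by simpa using h
  rw [← ofReal_norm, ← ENNReal.ofReal_pow (norm_nonneg _), ← h2.tsum_eq,
    ENNReal.ofReal_tsum_of_nonneg (fun _ => by positivity) h2.summable]
  simp only [ENNReal.ofReal_pow (norm_nonneg _), ofReal_norm]

/-- The upper frame bound makes the analysis map into ℓ² bounded; its adjoint sends unit vectors to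
the e_i, so continuity gives unconditional convergence. -/
theorem exists_synthesis {V : Submodule ℂ E} [CompleteSpace V] {e : ι → E} (he : ∀ i, e i ∈ V)
    {B : ℝ} (hB : ∀ f ∈ V, ∑' i, ‖inner ℂ (e i) f‖ₑ ^ 2 ≤ ENNReal.ofReal (B * ‖f‖ ^ 2)) :
    ∃ A : V →L[ℂ] ℓ²(ι, ℂ), (∀ f i, A f i = inner ℂ (e i) (f : E)) ∧
      ∀ c : ℓ²(ι, ℂ), HasSum (fun i => c i • e i) (A.adjoint c : E) := by
  have hmem (f : V) : Memℓp (fun i => inner ℂ (e i) (f : E)) 2 :=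
    memℓp_two_iff_tsum_enorm.mpr ((hB f f.2).trans_lt ENNReal.ofReal_lt_top).ne
  let A₀ : V →ₗ[ℂ] ℓ²(ι, ℂ) :=
    { toFun := fun f => ⟨_, hmem f⟩
      map_add' := fun f g => by
        ext i
        exact inner_add_right _ _ _
      map_smul' := fun a f => by
        ext i
        exact inner_smul_right _ _ _ }
  -- The sign of `B` is not given here, hence the maximum with 0.
  have hA₀ (f : V) : ‖A₀ f‖ ≤ √(max B 0) * ‖f‖ := by
    have h1 : ‖A₀ f‖ₑ ^ 2 ≤ ENNReal.ofReal (max B 0 * ‖f‖ ^ 2) := by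
      rw [lp_two_enorm_sq]
      refine (hB f f.2).trans (ENNReal.ofReal_le_ofReal ?_)
      exact mul_le_mul_of_nonneg_right (le_max_left _ _) (by positivity)
    rw [← ofReal_norm, ← ENNReal.ofReal_pow (norm_nonneg _),
      ENNReal.ofReal_le_ofReal_iff (by positivity)] at h1
    refine abs_le_of_sq_le_sq' ?_ (by positivity) |>.2
    rw [mul_pow, Real.sq_sqrt (le_max_right _ _)]
    exact h1
  refine ⟨A₀.mkContinuous _ hA₀, fun f i => rfl, fun c => ?_⟩
  classical
  have h := lp.hasSum_single (p := 2) (by norm_num) c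
  have h2 := (V.subtypeL ∘L (A₀.mkContinuous _ hA₀).adjoint).hasSum h
  have e1 (i : ι) : (V.subtypeL ∘L (A₀.mkContinuous _ hA₀).adjoint) (lp.single 2 i (c i)) =
      c i • e i := by
    have : (A₀.mkContinuous _ hA₀).adjoint (lp.single 2 i (c i)) = c i • (⟨e i, he i⟩ : V) := by
      refine ext_inner_right ℂ fun f => ?_
      rw [ContinuousLinearMap.adjoint_inner_left, lp.inner_single_left, inner_smul_left,
        Submodule.coe_inner, RCLike.inner_apply, mul_comm]
      rfl
    rw [ContinuousLinearMap.comp_apply, this]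
    rfl
  simp only [e1] at h2
  exact h2

/-- The lower frame bound makes the frame operator A*A coercive, hence invertible; solving A*A x = f
yields the coefficients A x. -/
theorem IsFrameFor.exists_hasSum [CompleteSpace E] {V : Submodule ℂ E} (hV : IsClosed (V : Set E))
    {e : ι → E} (h : IsFrameFor V e) {f : E} (hf : f ∈ V) :
    ∃ c : ι → ℂ, Memℓp c 2 ∧ HasSum (fun i => c i • e i) f := by
  have : CompleteSpace V := hV.completeSpace_coe
  obtain ⟨he, a, B, ha, hB, hb⟩ := h
  obtain ⟨A, hA, hs⟩ := exists_synthesis he fun f hf => (hb f hf).2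
  have hu : IsUnit (A.adjoint ∘L A) := by
    refine ContinuousLinearMap.isUnit_of_forall_le_norm_inner_map _
      (c := ⟨a, ha.le⟩) (by exact ha) fun x => ?_
    rw [ContinuousLinearMap.comp_apply, ContinuousLinearMap.adjoint_inner_left,
      inner_self_eq_norm_sq_to_K]
    have h1 := (hb x x.2).1
    simp only [← hA] at h1
    rw [← lp_two_enorm_sq, ← ofReal_norm, ← ENNReal.ofReal_pow (norm_nonneg _),
      ENNReal.ofReal_le_ofReal_iff (by positivity)] at h1
    simp only [norm_pow, RCLike.norm_ofReal, abs_norm]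
    rw [mul_comm]
    exact h1
  obtain ⟨x, hx⟩ := ((ContinuousLinearMap.isUnit_iff_bijective).mp hu).2 ⟨f, hf⟩
  refine ⟨A x, lp.memℓp _, ?_⟩
  have := hs (A x)
  rw [← ContinuousLinearMap.comp_apply, hx] at this
  exact this

end Bessel

/-- The space `L²(ℝ/ℤ)`. -/
noncomputable abbrev CircleL2 : Type := Lp ℂ 2 (AddCircle.haarAddCircle (T := (1 : ℝ)))

/-! ### Fourier series and multiplication operators on the circle. -/

namespace CircleL2

theorem clm_ext {F : Type*} [NormedAddCommGroup F] [NormedSpace ℂ F] {T T' : CircleL2 →L[ℂ] F}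
    (h : ∀ m, T (fourierLp 2 m) = T' (fourierLp 2 m)) : T = T' := by
  refine ContinuousLinearMap.ext_on (s := Set.range (fourierLp (T := (1 : ℝ)) 2)) ?_ ?_
  · rw [dense_iff_closure_eq, ← Submodule.topologicalClosure_coe,
      span_fourierLp_closure_eq_top (by norm_num)]
    rfl
  · rintro _ ⟨m, rfl⟩
    exact h m

theorem inner_fourierLp (h : CircleL2) (m : ℤ) : inner ℂ (fourierLp 2 m) h = fourierCoeff h m := by
  rw [← fourierBasis_repr, HilbertBasis.repr_apply_apply, coe_fourierBasis]

theorem tsum_enorm_inner_sq (h : CircleL2) :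
    ∑' m : ℤ, ‖inner ℂ (fourierLp 2 m) h‖ₑ ^ 2 = ‖h‖ₑ ^ 2 := by
  have := lp_two_enorm_sq (fourierBasis.repr h)
  simp only [HilbertBasis.repr_apply_apply, coe_fourierBasis] at this
  rw [← this, ← ofReal_norm, LinearIsometryEquiv.norm_map, ofReal_norm]

theorem ext_inner {h h' : CircleL2} (H : ∀ m, inner ℂ (fourierLp 2 m) h = inner ℂ (fourierLp 2 m)
    h') :
    h = h' := by
  refine fourierBasis.repr.injective (lp.ext (funext fun m => ?_))
  simpa only [HilbertBasis.repr_apply_apply, coe_fourierBasis] using H m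

theorem ae_eq_of_fourierCoeff_eq {f g : AddCircle (1 : ℝ) → ℂ}
    (hf : Integrable f AddCircle.haarAddCircle) (hg : Integrable g AddCircle.haarAddCircle)
    (h : ∀ m, fourierCoeff f m = fourierCoeff g m) : f =ᵐ[AddCircle.haarAddCircle] g := by
  have := (hf.sub hg).ae_eq_zero_of_fourierCoeff_eq_zero fun m => by
    have e : f = (f - g) + g := by simp
    have h1 := h m
    rw [e, fourierCoeff.add (hf.sub hg) hg, Pi.add_apply] at h1
    simpa using h1
  filter_upwards [this] with z hz
  exact sub_eq_zero.mp hz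

/-- Multiplication by a bounded function on `L²(ℝ/ℤ)`. -/
noncomputable def mulCLM (b : AddCircle (1 : ℝ) → ℂ) (C : ℝ)
    (hb : AEStronglyMeasurable b AddCircle.haarAddCircle)
    (hC : ∀ᵐ z ∂AddCircle.haarAddCircle, ‖b z‖ ≤ C) : CircleL2 →L[ℂ] CircleL2 :=
  have hm (h : CircleL2) : MemLp (fun z => b z * h z) 2 AddCircle.haarAddCircle :=
    (Lp.memLp h).mul (memLp_top_of_bound hb C hC)
  LinearMap.mkContinuous
    { toFun := fun h => (hm h).toLp
      map_add' := fun h h' => by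
        rw [← MemLp.toLp_add]
        refine MemLp.toLp_congr _ _ ?_
        filter_upwards [Lp.coeFn_add h h'] with z hz
        simp only [hz, Pi.add_apply, mul_add]
      map_smul' := fun c h => by
        rw [RingHom.id_apply, ← MemLp.toLp_const_smul]
        refine MemLp.toLp_congr _ _ ?_
        filter_upwards [Lp.coeFn_smul c h] with z hz
        simp only [hz, Pi.smul_apply, smul_eq_mul, mul_left_comm] }
    C fun h => by
      refine Lp.norm_le_mul_norm_of_ae_le_mul ?_
      filter_upwards [(hm h).coeFn_toLp, hC] with z hz hz2
      change ‖((hm h).toLp : _ → ℂ) z‖ ≤ _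
      rw [hz, norm_mul]
      exact mul_le_mul_of_nonneg_right hz2 (norm_nonneg _)

variable {b b' : AddCircle (1 : ℝ) → ℂ} {C C' : ℝ}
    (hb : AEStronglyMeasurable b AddCircle.haarAddCircle)
    (hC : ∀ᵐ z ∂AddCircle.haarAddCircle, ‖b z‖ ≤ C)

theorem coeFn_mulCLM (h : CircleL2) :
    mulCLM b C hb hC h =ᵐ[AddCircle.haarAddCircle] fun z => b z * h z :=
  MemLp.coeFn_toLp ((Lp.memLp h).mul (memLp_top_of_bound hb C hC))

theorem norm_mulCLM_le (h : CircleL2) : ‖mulCLM b C hb hC h‖ ≤ C * ‖h‖ := by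
  refine Lp.norm_le_mul_norm_of_ae_le_mul ?_
  filter_upwards [coeFn_mulCLM hb hC h, hC] with z hz hz2
  rw [hz, norm_mul]
  exact mul_le_mul_of_nonneg_right hz2 (norm_nonneg _)

theorem inner_mulCLM (hr : ∀ z, star (b z) = b z) (h h' : CircleL2) :
    inner ℂ (mulCLM b C hb hC h) h' = inner ℂ h (mulCLM b C hb hC h') := by
  rw [L2.inner_def, L2.inner_def]
  refine integral_congr_ae ?_
  filter_upwards [coeFn_mulCLM hb hC h, coeFn_mulCLM hb hC h'] with z h1 h2
  have h3 : (starRingEnd ℂ) (b z) = b z := hr z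
  rw [h1, h2, RCLike.inner_apply, RCLike.inner_apply, map_mul, h3]
  ring

theorem norm_fourier_le (m : ℤ) :
    ∀ᵐ z ∂(AddCircle.haarAddCircle (T := (1 : ℝ))), ‖fourier m z‖ ≤ 1 :=
  Eventually.of_forall fun z => by rw [fourier_apply, Circle.norm_coe]

/-- Multiplication by the character `e^{2πimλ}`. -/
noncomputable def mulFourier (m : ℤ) : CircleL2 →L[ℂ] CircleL2 :=
  mulCLM (fourier m) 1 (fourier m).continuous.aestronglyMeasurable (norm_fourier_le m)

theorem coeFn_mulFourier (m : ℤ) (h : CircleL2) :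
    mulFourier m h =ᵐ[AddCircle.haarAddCircle] fun z => fourier m z * h z :=
  coeFn_mulCLM _ _ h

theorem mulFourier_fourierLp (m j : ℤ) : mulFourier m (fourierLp 2 j) = fourierLp 2 (m + j) := by
  refine Lp.ext ?_
  filter_upwards [coeFn_mulFourier m (fourierLp 2 j), coeFn_fourierLp (T := (1 : ℝ)) 2 j,
    coeFn_fourierLp (T := (1 : ℝ)) 2 (m + j)] with z h1 h2 h3
  rw [h1, h2, h3, fourier_add]

theorem integrable_mul (x y : CircleL2) :
    Integrable (fun z => x z * y z) AddCircle.haarAddCircle :=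
  (Lp.memLp x).integrable_mul (Lp.memLp y)

theorem memLp_star (x : CircleL2) :
    MemLp (fun z => star (x z)) 2 AddCircle.haarAddCircle := (Lp.memLp x).star

/-- The Fourier coefficients of a product are the convolution of the Fourier coefficients. -/
theorem hasSum_fourierCoeff_mul (x y : CircleL2) (s : ℤ) :
    HasSum (fun j => fourierCoeff x j * fourierCoeff y (s - j))
      (fourierCoeff (fun z => x z * y z) s) := by
  have h := fourierBasis.hasSum_inner_mul_inner (mulFourier s (memLp_star y).toLp) x
  rw [coe_fourierBasis] at h
  have e1 (j : ℤ) : inner ℂ (mulFourier s (memLp_star y).toLp) (fourierLp 2 j) =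
      fourierCoeff y (s - j) := by
    rw [L2.inner_def, fourierCoeff]
    refine integral_congr_ae ?_
    filter_upwards [coeFn_mulFourier s (memLp_star y).toLp, (memLp_star y).coeFn_toLp,
      coeFn_fourierLp (T := (1 : ℝ)) 2 j] with z h1 h2 h3
    rw [h1, h2, h3, RCLike.inner_apply, map_mul, smul_eq_mul, neg_sub, sub_eq_add_neg, fourier_add,
      fourier_neg]
    simp
    ring
  have e2 : inner ℂ (mulFourier s (memLp_star y).toLp) x = fourierCoeff (fun z => x z * y z) s := by
    rw [L2.inner_def, fourierCoeff]
    refine integral_congr_ae ?_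
    filter_upwards [coeFn_mulFourier s (memLp_star y).toLp, (memLp_star y).coeFn_toLp] with z h1 h2
    rw [h1, h2, RCLike.inner_apply, map_mul, smul_eq_mul, fourier_neg]
    simp
    ring
  rw [e2] at h
  simp only [e1, inner_fourierLp] at h
  simpa only [mul_comm] using h

end CircleL2

end

/-! ### The synthesis operator of the central translates. -/

namespace Heis

variable {n : ℕ}

/-- Left translation on `L²(ℍⁿ)`. -/
noncomputable def translate (a : Heis n) : L2 n →ₗᵢ[ℂ] L2 n :=
  Lp.compMeasurePreservingₗᵢ ℂ (fun X => a⁻¹ * X) (measurePreserving_mul_left a⁻¹)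

theorem translate_toLp (a : Heis n) {f : Heis n → ℂ} (hf : MemLp f 2 volume) :
    translate a hf.toLp = (memLp_leftTranslate a hf).toLp :=
  Lp.toLp_compMeasurePreserving hf (measurePreserving_mul_left a⁻¹)

theorem translate_mul (a b : Heis n) (f : L2 n) :
    translate (a * b) f = translate a (translate b f) := by
  have h := Lp.toLp_coeFn f (Lp.memLp f)
  rw [← h, translate_toLp, translate_toLp, translate_toLp]
  simp only [leftTranslate_mul]

theorem translate_one (f : L2 n) : translate 1 f = f := by
  have h := Lp.toLp_coeFn f (Lp.memLp f)
  rw [← h, translate_toLp]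
  simp only [leftTranslate_one]

theorem inner_translate_left (a : Heis n) (f g : L2 n) :
    inner ℂ (translate a f) g = inner ℂ f (translate a⁻¹ g) := by
  rw [← (translate a⁻¹).inner_map_map, ← translate_mul, inv_mul_cancel, translate_one]

theorem latticeTranslates_eq {φ : Heis n → ℂ} (hφ : MemLp φ 2 volume)
    (p : (Fin n → ℤ) × (Fin n → ℤ) × ℤ) :
    latticeTranslates hφ p = translate (lat p.1 p.2.1 p.2.2) hφ.toLp :=
  (translate_toLp _ hφ).symm

theorem lat_mul_central (k l : Fin n → ℤ) (m j : ℤ) :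
    lat k l m * mk 0 0 (j : ℝ) = lat k l (m + j) := by
  ext i <;> simp [lat]

theorem central_mul_lat (k l : Fin n → ℤ) (m j : ℤ) :
    mk 0 0 (j : ℝ) * lat k l m = lat k l (j + m) := by
  ext i <;> simp [lat]

theorem lat_zero_zero (m : ℤ) : lat (0 : Fin n → ℤ) 0 m = mk 0 0 (m : ℝ) := by
  ext i <;> simp [lat]

theorem inv_central (m : ℤ) : (mk 0 0 (m : ℝ) : Heis n)⁻¹ = mk 0 0 ((-m : ℤ) : ℝ) := by
  ext i <;> simp

theorem inner_latticeTranslates_central {φ : Heis n → ℂ} (hφ : MemLp φ 2 volume)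
    (k l : Fin n → ℤ) (m j : ℤ) :
    inner ℂ (latticeTranslates hφ (k, l, m)) (latticeTranslates hφ (0, 0, j)) =
      inner ℂ (latticeTranslates hφ (k, l, m - j)) hφ.toLp := by
  simp only [latticeTranslates_eq, lat_zero_zero]
  rw [show mk 0 0 (j : ℝ) = (mk 0 0 ((-j : ℤ) : ℝ) : Heis n)⁻¹ by rw [inv_central, neg_neg],
    ← inner_translate_left, ← translate_mul, central_mul_lat, neg_add_eq_sub]

section Synthesis

open CircleL2

variable {φ : Heis n → ℂ} (hφ : MemLp φ 2 volume)

/-- The central translates form a subfamily of the frame, so they inherit its upper bound, and the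
Fourier basis identifies ℓ²(ℤ) with L²(ℝ/ℤ). -/
theorem exists_circleSynthesis {V : Submodule ℂ (L2 n)} (hV : IsClosed (V : Set (L2 n)))
    (h : IsFrameFor V (latticeTranslates hφ)) :
    ∃ S : CircleL2 →L[ℂ] L2 n, ∀ m, S (fourierLp 2 m) = latticeTranslates hφ (0, 0, m) := by
  have : CompleteSpace V := hV.completeSpace_coe
  obtain ⟨he, a, B, ha, hB, hb⟩ := h
  obtain ⟨A, -, hs⟩ := exists_synthesis (V := V)
    (e := fun m : ℤ => latticeTranslates hφ ((0, 0, m) : (Fin n → ℤ) × (Fin n → ℤ) × ℤ))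
    (fun m => he _) (B := B) fun f hf => (ENNReal.tsum_comp_le_tsum_of_injective
      (fun m m' hm => by simpa using hm)
      (fun p => ‖inner ℂ (latticeTranslates hφ p) f‖ₑ ^ 2)).trans (hb f hf).2
  refine ⟨V.subtypeL ∘L A.adjoint ∘L
    (fourierBasis (T := (1 : ℝ))).repr.toContinuousLinearEquiv.toContinuousLinearMap, fun m => ?_⟩
  have h1 := hs (fourierBasis.repr (fourierLp (T := (1 : ℝ)) 2 m))
  have h2 (i : ℤ) : fourierBasis.repr (fourierLp (T := (1 : ℝ)) 2 m) i = if i = m then 1 else 0 :=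
      by
    rw [HilbertBasis.repr_apply_apply, coe_fourierBasis,
      orthonormal_iff_ite.mp orthonormal_fourier]
  have h3 := hasSum_single (f := fun i => fourierBasis.repr (fourierLp (T := (1 : ℝ)) 2 m) i •
    latticeTranslates hφ ((0, 0, i) : (Fin n → ℤ) × (Fin n → ℤ) × ℤ)) m fun i hi => by simp [h2, hi]
  have h4 := h1.unique h3
  rw [h2, if_pos rfl, one_smul] at h4
  exact h4

variable {hφ} {S : CircleL2 →L[ℂ] L2 n}

theorem translate_circleSynthesis_fourierLp
    (hS : ∀ m, S (fourierLp 2 m) = latticeTranslates hφ (0, 0, m)) (k l : Fin n → ℤ) (m : ℤ) :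
    translate (lat k l 0) (S (fourierLp 2 m)) = latticeTranslates hφ (k, l, m) := by
  rw [hS, latticeTranslates_eq, latticeTranslates_eq, ← translate_mul, lat_zero_zero,
    ← lat_eq_mul_central]

theorem hasSum_translate_circleSynthesis
    (hS : ∀ m, S (fourierLp 2 m) = latticeTranslates hφ (0, 0, m)) (k l : Fin n → ℤ) (h :
        CircleL2) :
    HasSum (fun m => fourierCoeff h m • latticeTranslates hφ (k, l, m))
      (translate (lat k l 0) (S h)) := by
  have h1 := ((translate (lat k l 0)).toContinuousLinearMap ∘L S).hasSum
    (hasSum_fourier_series_L2 h)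
  simp only [map_smul, ContinuousLinearMap.comp_apply, LinearIsometry.coe_toContinuousLinearMap,
    translate_circleSynthesis_fourierLp hS] at h1
  exact h1

theorem translate_central_circleSynthesis
    (hS : ∀ m, S (fourierLp 2 m) = latticeTranslates hφ (0, 0, m)) (m : ℤ) (h : CircleL2) :
    translate (mk 0 0 (m : ℝ)) (S h) = S (mulFourier m h) := by
  have : (translate (mk 0 0 (m : ℝ))).toContinuousLinearMap ∘L S = S ∘L mulFourier m := by
    refine clm_ext fun j => ?_
    simp only [ContinuousLinearMap.comp_apply, LinearIsometry.coe_toContinuousLinearMap,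
      mulFourier_fourierLp, hS]
    rw [latticeTranslates_eq, latticeTranslates_eq, ← translate_mul, central_mul_lat]
  exact congrArg (fun T => T h) this

/-- Condition C gives the vanishing for pairs of characters, and boundedness extends it to all h and
h'. -/
theorem inner_translate_circleSynthesis_eq_zero
    (hS : ∀ m, S (fourierLp 2 m) = latticeTranslates hφ (0, 0, m)) (hC : ConditionC φ) {k l : Fin
        n → ℤ}
    (hkl : (k, l) ≠ (0, 0)) (h h' : CircleL2) :
    inner ℂ (translate (lat k l 0) (S h)) (S h') = 0 := by
  have key : (S.adjoint ∘L (translate (lat k l 0)).toContinuousLinearMap) ∘L S = 0 := by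
    refine clm_ext fun m => ?_
    rw [zero_apply]
    refine ext_inner fun j => ?_
    simp only [ContinuousLinearMap.comp_apply, LinearIsometry.coe_toContinuousLinearMap]
    rw [ContinuousLinearMap.adjoint_inner_right, translate_circleSynthesis_fourierLp hS, hS,
      ← inner_conj_symm, inner_latticeTranslates_central, (conditionC_iff hφ).mp hC k l hkl]
    simp
  have h2 := congrArg (fun T => T h) key
  simp only [ContinuousLinearMap.comp_apply, LinearIsometry.coe_toContinuousLinearMap] at h2
  rw [← ContinuousLinearMap.adjoint_inner_left, h2, zero_apply, inner_zero_left]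

theorem adjoint_circleSynthesis_fourierLp
    (hS : ∀ m, S (fourierLp 2 m) = latticeTranslates hφ (0, 0, m)) (m : ℤ) :
    S.adjoint (S (fourierLp 2 m)) =ᵐ[AddCircle.haarAddCircle]
      fun z => (_root_.fourier m z : ℂ) * (weight φ z : ℂ) := by
  have hw : Integrable (fun z => (weight φ z : ℂ)) AddCircle.haarAddCircle :=
    (integrable_weight hφ).ofReal
  refine ae_eq_of_fourierCoeff_eq ((Lp.memLp _).integrable (by norm_num))
    (hw.bdd_mul (_root_.fourier m).continuous.aestronglyMeasurable (norm_fourier_le m)) fun j => ?_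
  rw [← inner_fourierLp, ContinuousLinearMap.adjoint_inner_right, hS, hS,
    inner_latticeTranslates_central, ← fourierCoeff_weight hφ]
  unfold fourierCoeff
  refine integral_congr_ae (Eventually.of_forall fun z => ?_)
  simp only [smul_eq_mul]
  rw [← mul_assoc, ← fourier_add]
  congr 3
  ring

/-- The Gram matrix of the central translates is Toeplitz with symbol `weight`. -/
theorem adjoint_circleSynthesis
    (hS : ∀ m, S (fourierLp 2 m) = latticeTranslates hφ (0, 0, m)) (h : CircleL2) :
    S.adjoint (S h) =ᵐ[AddCircle.haarAddCircle] fun z => (weight φ z : ℂ) * h z := by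
  -- This also shows that `weight` agrees almost everywhere with an L² function, so its product with
  -- h is integrable and has Fourier coefficients to compare.
  have h0 := adjoint_circleSynthesis_fourierLp hS 0
  have hi : Integrable (fun z => (weight φ z : ℂ) * h z) AddCircle.haarAddCircle := by
    refine (integrable_mul (S.adjoint (S (fourierLp 2 0))) h).congr ?_
    filter_upwards [h0] with z hz
    rw [hz, fourier_zero, one_mul]
  refine ae_eq_of_fourierCoeff_eq ((Lp.memLp _).integrable (by norm_num)) hi fun m => ?_
  rw [← inner_fourierLp, ContinuousLinearMap.adjoint_inner_right,
    ← ContinuousLinearMap.adjoint_inner_left, L2.inner_def, fourierCoeff]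
  refine integral_congr_ae ?_
  filter_upwards [adjoint_circleSynthesis_fourierLp hS m] with z hz
  rw [hz, RCLike.inner_apply, map_mul, fourier_neg, smul_eq_mul]
  have : (starRingEnd ℂ) (weight φ z : ℂ) = weight φ z := Complex.conj_ofReal _
  rw [this]
  ring

/-- The squared norm of S h is the integral of `weight` times |h|². -/
theorem circleSynthesis_eq_zero
    (hS : ∀ m, S (fourierLp 2 m) = latticeTranslates hφ (0, 0, m)) {h : CircleL2}
    (hz : ∀ᵐ z ∂AddCircle.haarAddCircle, weight φ z ≠ 0 → h z = 0) : S h = 0 := by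
  rw [← inner_self_eq_zero (𝕜 := ℂ), ← ContinuousLinearMap.adjoint_inner_right, L2.inner_def]
  refine integral_eq_zero_of_ae ?_
  filter_upwards [adjoint_circleSynthesis hS h, hz] with z h1 h2
  rw [h1]
  by_cases hw : weight φ z = 0
  · simp [hw]
  · simp [h2 hw]

theorem circleSynthesis_congr
    (hS : ∀ m, S (fourierLp 2 m) = latticeTranslates hφ (0, 0, m)) {h h' : CircleL2}
    (hz : ∀ᵐ z ∂AddCircle.haarAddCircle, weight φ z ≠ 0 → h z = h' z) : S h = S h' := by
  rw [← sub_eq_zero, ← map_sub]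
  refine circleSynthesis_eq_zero hS ?_
  filter_upwards [hz, Lp.coeFn_sub h h'] with z h1 h2 hw
  rw [h2, Pi.sub_apply, h1 hw, sub_self]

end Synthesis

end Heis

/-! ### The dual window ψ = S(1/p). -/

namespace Heis

open CircleL2

variable {n : ℕ}

/-- `Mp` and `Mb` are the multiplications by `p` and `1 / p`, where `p` is bounded above and below
on
the set where the weight of `φ` does not vanish, and vanishes elsewhere. -/
structure IsMultiplierPair (φ : Heis n → ℂ) (p : AddCircle (1 : ℝ) → ℝ) (A B : ℝ)
    (Mp Mb : CircleL2 →L[ℂ] CircleL2) : Prop where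
  pos_left : 0 < A
  pos_right : 0 < B
  ne_zero : ∀ᵐ z ∂AddCircle.haarAddCircle, weight φ z ≠ 0 → p z ≠ 0
  coeFn_left : ∀ h, Mp h =ᵐ[AddCircle.haarAddCircle] fun z => (p z : ℂ) * h z
  coeFn_right : ∀ h, Mb h =ᵐ[AddCircle.haarAddCircle] fun z => ((p z)⁻¹ : ℝ) * h z
  norm_left : ∀ h, ‖Mp h‖ ≤ B * ‖h‖
  norm_right : ∀ h, ‖Mb h‖ ≤ A⁻¹ * ‖h‖
  inner_left : ∀ h h', inner ℂ (Mp h) h' = inner ℂ h (Mp h')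
  inner_right : ∀ h h', inner ℂ (Mb h) h' = inner ℂ h (Mb h')

theorem exists_isMultiplierPair {φ : Heis n → ℂ} {p : AddCircle (1 : ℝ) → ℝ} {A B : ℝ}
    (hA : 0 < A) (hB : 0 < B) (hp : AEStronglyMeasurable p AddCircle.haarAddCircle)
    (h1 : ∀ᵐ z ∂AddCircle.haarAddCircle, weight φ z ≠ 0 → A ≤ p z ∧ p z ≤ B)
    (h2 : ∀ᵐ z ∂AddCircle.haarAddCircle, weight φ z = 0 → p z = 0) :
    ∃ Mp Mb, IsMultiplierPair φ p A B Mp Mb := by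
  have b1 : ∀ᵐ z ∂AddCircle.haarAddCircle, ‖(p z : ℂ)‖ ≤ B := by
    filter_upwards [h1, h2] with z a1 a2
    rw [Complex.norm_real, Real.norm_eq_abs]
    by_cases hz : weight φ z = 0
    · simp [a2 hz, hB.le]
    · rw [abs_of_nonneg (hA.le.trans (a1 hz).1)]
      exact (a1 hz).2
  have b2 : ∀ᵐ z ∂AddCircle.haarAddCircle, ‖(((p z)⁻¹ : ℝ) : ℂ)‖ ≤ A⁻¹ := by
    filter_upwards [h1, h2] with z a1 a2
    rw [Complex.norm_real, Real.norm_eq_abs]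
    by_cases hz : weight φ z = 0
    -- The convention 0⁻¹ = 0 makes 1/p vanish off the support of the weight, so the bound persists
    -- there.
    · simp [a2 hz, hA.le]
    · rw [abs_of_nonneg (inv_nonneg.mpr (hA.le.trans (a1 hz).1))]
      exact inv_anti₀ hA (a1 hz).1
  have m1 : AEStronglyMeasurable (fun z => (p z : ℂ)) AddCircle.haarAddCircle :=
    Complex.continuous_ofReal.comp_aestronglyMeasurable hp
  have m2 : AEStronglyMeasurable (fun z => (((p z)⁻¹ : ℝ) : ℂ)) AddCircle.haarAddCircle :=
    Complex.continuous_ofReal.comp_aestronglyMeasurable hp.aemeasurable.inv.aestronglyMeasurable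
  refine ⟨mulCLM _ B m1 b1, mulCLM _ A⁻¹ m2 b2, hA, hB, ?_, coeFn_mulCLM m1 b1, coeFn_mulCLM m2 b2,
    norm_mulCLM_le m1 b1, norm_mulCLM_le m2 b2,
    inner_mulCLM m1 b1 fun z => Complex.conj_ofReal _,
    inner_mulCLM m2 b2 fun z => Complex.conj_ofReal _⟩
  filter_upwards [h1] with z hz hw
  exact (hA.trans_le (hz hw).1).ne'

variable {φ : Heis n → ℂ} {hφ : MemLp φ 2 volume} {S : CircleL2 →L[ℂ] L2 n}
  {p : AddCircle (1 : ℝ) → ℝ} {A B : ℝ} {Mp Mb : CircleL2 →L[ℂ] CircleL2}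

namespace IsMultiplierPair

theorem mulFourier_comm (hM : IsMultiplierPair φ p A B Mp Mb) (m : ℤ) (h : CircleL2) :
    mulFourier m (Mb h) = Mb (mulFourier m h) := by
  refine Lp.ext ?_
  filter_upwards [coeFn_mulFourier m (Mb h), hM.coeFn_right h, hM.coeFn_right (mulFourier m h),
    coeFn_mulFourier m h] with z h1 h2 h3 h4
  rw [h1, h2, h3, h4]
  ring

/-- The product of the two multipliers is 1 only where p ≠ 0, but `S` ignores the values of h
wherever the weight vanishes. -/
theorem circleSynthesis_mul (hM : IsMultiplierPair φ p A B Mp Mb)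
    (hS : ∀ m, S (fourierLp 2 m) = latticeTranslates hφ (0, 0, m)) (h : CircleL2) :
    S (Mb (Mp h)) = S h := by
  refine circleSynthesis_congr hS ?_
  filter_upwards [hM.coeFn_right (Mp h), hM.coeFn_left h, hM.ne_zero] with z h1 h2 h3 hw
  rw [h1, h2, ← mul_assoc, ← Complex.ofReal_mul, inv_mul_cancel₀ (h3 hw), Complex.ofReal_one,
    one_mul]

theorem adjoint_circleSynthesis_mul (hM : IsMultiplierPair φ p A B Mp Mb)
    (hS : ∀ m, S (fourierLp 2 m) = latticeTranslates hφ (0, 0, m)) (g : L2 n) :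
    Mp (Mb (S.adjoint g)) = S.adjoint g := by
  refine ext_inner_left ℂ fun x => ?_
  rw [← hM.inner_left, ← hM.inner_right, ContinuousLinearMap.adjoint_inner_right,
    hM.circleSynthesis_mul hS, ContinuousLinearMap.adjoint_inner_right]

end IsMultiplierPair

section Dual

variable {ψ : Heis n → ℂ} {hψ : MemLp ψ 2 volume}

/-- Under `S`, central translations are multiplications by characters and so commute with 1/p. -/
theorem latticeTranslates_dual (hM : IsMultiplierPair φ p A B Mp Mb)
    (hS : ∀ m, S (fourierLp 2 m) = latticeTranslates hφ (0, 0, m))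
    (hψS : hψ.toLp = S (Mb (fourierLp 2 0))) (k l : Fin n → ℤ) (m : ℤ) :
    latticeTranslates hψ (k, l, m) = translate (lat k l 0) (S (Mb (fourierLp 2 m))) := by
  rw [latticeTranslates_eq, lat_eq_mul_central, translate_mul, hψS,
    translate_central_circleSynthesis hS, hM.mulFourier_comm, mulFourier_fourierLp, add_zero]

theorem hasSum_latticeTranslates_dual (hM : IsMultiplierPair φ p A B Mp Mb)
    (hS : ∀ m, S (fourierLp 2 m) = latticeTranslates hφ (0, 0, m))
    (hψS : hψ.toLp = S (Mb (fourierLp 2 0))) (k l : Fin n → ℤ) (h : CircleL2) :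
    HasSum (fun m => fourierCoeff (Mp h) m • latticeTranslates hψ (k, l, m))
      (translate (lat k l 0) (S h)) := by
  have h1 := ((translate (lat k l 0)).toContinuousLinearMap ∘L S ∘L Mb).hasSum
    (hasSum_fourier_series_L2 (Mp h))
  simp only [map_smul, ContinuousLinearMap.comp_apply, LinearIsometry.coe_toContinuousLinearMap,
    ← latticeTranslates_dual hM hS hψS, hM.circleSynthesis_mul hS] at h1
  exact h1

theorem conditionC_dual (hC : ConditionC φ) (hM : IsMultiplierPair φ p A B Mp Mb)
    (hS : ∀ m, S (fourierLp 2 m) = latticeTranslates hφ (0, 0, m))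
    (hψS : hψ.toLp = S (Mb (fourierLp 2 0))) : ConditionC ψ := by
  refine (conditionC_iff hψ).mpr fun k l hkl m => ?_
  rw [latticeTranslates_dual hM hS hψS, hψS]
  exact inner_translate_circleSynthesis_eq_zero hS hC hkl _ _

theorem tsum_enorm_inner_latticeTranslates
    (hS : ∀ m, S (fourierLp 2 m) = latticeTranslates hφ (0, 0, m)) (f : L2 n) (k l : Fin n → ℤ) :
    ∑' m : ℤ, ‖inner ℂ (latticeTranslates hφ (k, l, m)) f‖ₑ ^ 2 =
      ‖S.adjoint (translate (lat k l 0)⁻¹ f)‖ₑ ^ 2 := by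
  rw [← tsum_enorm_inner_sq]
  refine tsum_congr fun m => ?_
  rw [← translate_circleSynthesis_fourierLp hS, inner_translate_left,
    ContinuousLinearMap.adjoint_inner_right]

theorem tsum_enorm_inner_latticeTranslates_dual (hM : IsMultiplierPair φ p A B Mp Mb)
    (hS : ∀ m, S (fourierLp 2 m) = latticeTranslates hφ (0, 0, m))
    (hψS : hψ.toLp = S (Mb (fourierLp 2 0))) (f : L2 n) (k l : Fin n → ℤ) :
    ∑' m : ℤ, ‖inner ℂ (latticeTranslates hψ (k, l, m)) f‖ₑ ^ 2 =
      ‖Mb (S.adjoint (translate (lat k l 0)⁻¹ f))‖ₑ ^ 2 := by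
  rw [← tsum_enorm_inner_sq]
  refine tsum_congr fun m => ?_
  rw [latticeTranslates_dual hM hS hψS, inner_translate_left,
    ← ContinuousLinearMap.adjoint_inner_right, hM.inner_right]

theorem enorm_sq_le_of_norm_le {E F : Type*} [NormedAddCommGroup E] [NormedAddCommGroup F] {x : E}
    {y : F} {c : ℝ} (hc : 0 ≤ c) (h : ‖x‖ ≤ c * ‖y‖) : ‖x‖ₑ ^ 2 ≤ ENNReal.ofReal (c ^ 2) * ‖y‖ₑ ^
        2 := by
  rw [ENNReal.ofReal_pow hc, ← mul_pow]
  gcongr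
  rw [← ofReal_norm, ← ofReal_norm, ← ENNReal.ofReal_mul hc]
  exact ENNReal.ofReal_le_ofReal h

/-- Within each (k,l) block the coefficients against φ and ψ are the Fourier coefficients of w = S*
L_{(2k,l,0)}⁻¹ f and of w/p. Since p · (w/p) = w by `adjoint_circleSynthesis_mul`, their norms are
comparable with constants A⁻¹ and B, and the frame bounds change by the squares of these. -/
theorem isFrameFor_dual {V : Submodule ℂ (L2 n)} (hV : IsClosed (V : Set (L2 n)))
    (hF : IsFrameFor V (latticeTranslates hφ)) (hM : IsMultiplierPair φ p A B Mp Mb)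
    (hS : ∀ m, S (fourierLp 2 m) = latticeTranslates hφ (0, 0, m))
    (hψS : hψ.toLp = S (Mb (fourierLp 2 0))) : IsFrameFor V (latticeTranslates hψ) := by
  obtain ⟨he, a, b, ha, hb, hab⟩ := hF
  have hA := hM.pos_left
  have hB := hM.pos_right
  refine ⟨fun q => ?_, (B ^ 2)⁻¹ * a, (A⁻¹) ^ 2 * b, by positivity, by positivity, fun f hf => ?_⟩
  · obtain ⟨k, l, m⟩ := q
    rw [latticeTranslates_dual hM hS hψS]
    exact hV.mem_of_tendsto (hasSum_translate_circleSynthesis hS k l _)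
      (Eventually.of_forall fun s => V.sum_mem fun i _ => V.smul_mem _ (he _))
  · have u1 : ∑' q, ‖inner ℂ (latticeTranslates hψ q) f‖ₑ ^ 2 ≤
        ENNReal.ofReal ((A⁻¹) ^ 2) * ∑' q, ‖inner ℂ (latticeTranslates hφ q) f‖ₑ ^ 2 := by
      simp only [ENNReal.tsum_prod', tsum_enorm_inner_latticeTranslates hS,
        tsum_enorm_inner_latticeTranslates_dual hM hS hψS, ← ENNReal.tsum_mul_left]
      refine ENNReal.tsum_le_tsum fun k => ENNReal.tsum_le_tsum fun l => ?_
      exact enorm_sq_le_of_norm_le (by positivity) (hM.norm_right _)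
    have u2 : ∑' q, ‖inner ℂ (latticeTranslates hφ q) f‖ₑ ^ 2 ≤
        ENNReal.ofReal (B ^ 2) * ∑' q, ‖inner ℂ (latticeTranslates hψ q) f‖ₑ ^ 2 := by
      simp only [ENNReal.tsum_prod', tsum_enorm_inner_latticeTranslates hS,
        tsum_enorm_inner_latticeTranslates_dual hM hS hψS, ← ENNReal.tsum_mul_left]
      refine ENNReal.tsum_le_tsum fun k => ENNReal.tsum_le_tsum fun l => ?_
      refine enorm_sq_le_of_norm_le hB.le ?_
      conv_lhs => rw [← hM.adjoint_circleSynthesis_mul hS]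
      exact hM.norm_left _
    constructor
    · rw [mul_assoc, ENNReal.ofReal_mul (by positivity)]
      calc ENNReal.ofReal (B ^ 2)⁻¹ * ENNReal.ofReal (a * ‖f‖ ^ 2)
          ≤ ENNReal.ofReal (B ^ 2)⁻¹ *
            (ENNReal.ofReal (B ^ 2) * ∑' q, ‖inner ℂ (latticeTranslates hψ q) f‖ₑ ^ 2) := by
            gcongr
            exact ((hab f hf).1).trans u2
        _ = _ := by
            rw [← mul_assoc, ← ENNReal.ofReal_mul (by positivity), inv_mul_cancel₀ (by positivity),
              ENNReal.ofReal_one, one_mul]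
    · refine u1.trans ?_
      rw [mul_assoc, ENNReal.ofReal_mul (by positivity)]
      gcongr
      exact (hab f hf).2

end Dual

end Heis

/-! ### Pointwise convergence and discrete convolution. -/

section

open scoped lp

/-- The sum at x is the ℓ² pairing of c with a vector of norm bounded independently of x.
Cauchy–Schwarz makes the convergence uniform, so continuity survives. -/
theorem exists_continuous_hasSum_of_bounded {X : Type*} [TopologicalSpace X] {f : ℤ → X → ℂ}
    (hf : ∀ m, Continuous (f m)) (hsup : (⨆ x, ∑' m, ‖f m x‖ₑ ^ 2) < ⊤) {c : ℤ → ℂ}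
    (hc : Memℓp c 2) :
    ∃ g : X → ℂ, Continuous g ∧ ∀ x, HasSum (fun m => c m * f m x) (g x) := by
  set M := ⨆ x, ∑' m, ‖f m x‖ₑ ^ 2 with hM
  have hle (x : X) : ∑' m, ‖f m x‖ₑ ^ 2 ≤ M := le_iSup (fun x => ∑' m, ‖f m x‖ₑ ^ 2) x
  have es (z : ℂ) : ‖star z‖ₑ = ‖z‖ₑ := by rw [← ofReal_norm, norm_star, ofReal_norm]
  have hmem (x : X) : Memℓp (fun m => star (f m x)) 2 := by
    refine memℓp_two_iff_tsum_enorm.mpr ?_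
    simp only [es]
    exact ((hle x).trans_lt hsup).ne
  let v (x : X) : ℓ²(ℤ, ℂ) := ⟨_, hmem x⟩
  have hv (x : X) : ‖v x‖ ≤ √M.toReal := by
    refine Real.le_sqrt_of_sq_le ?_
    rw [← ENNReal.ofReal_le_ofReal_iff ENNReal.toReal_nonneg, ENNReal.ofReal_toReal hsup.ne,
      ENNReal.ofReal_pow (norm_nonneg _), ofReal_norm, lp_two_enorm_sq]
    refine le_of_eq_of_le ?_ (hle x)
    exact tsum_congr fun m => by rw [← es (f m x)]
  let c' : ℓ²(ℤ, ℂ) := ⟨c, hc⟩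
  have hsum (x : X) : HasSum (fun m => c m * f m x) (inner ℂ (v x) c') := by
    have e : (fun m => c m * f m x) = fun m => inner ℂ (v x m) (c' m) := by
      funext m
      change _ = inner ℂ (star (f m x)) (c m)
      rw [RCLike.inner_apply]
      simp
    rw [e]
    exact lp.hasSum_inner (𝕜 := ℂ) (v x) c'
  refine ⟨fun x => inner ℂ (v x) c', ?_, hsum⟩
  have hlim := lp.hasSum_single (p := 2) (by norm_num) c'
  have hpart (s : Finset ℤ) (x : X) :
      inner ℂ (v x) (∑ m ∈ s, lp.single 2 m (c' m)) = ∑ m ∈ s, c m * f m x := by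
    rw [inner_sum]
    refine Finset.sum_congr rfl fun m _ => ?_
    rw [lp.inner_single_right]
    change inner ℂ (star (f m x)) (c m) = _
    rw [RCLike.inner_apply]
    simp
  have hu : TendstoUniformly (fun (s : Finset ℤ) x => ∑ m ∈ s, c m * f m x)
      (fun x => inner ℂ (v x) c') atTop := by
    rw [Metric.tendstoUniformly_iff]
    intro ε hε
    have h1 := (Metric.tendsto_nhds.mp hlim) (ε / (√M.toReal + 1)) (by positivity)
    filter_upwards [h1] with s hs x
    rw [← hpart, dist_eq_norm, ← inner_sub_right]
    rw [dist_comm, dist_eq_norm, lt_div_iff₀ (by positivity)] at hs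
    refine (norm_inner_le_norm _ _).trans_lt (lt_of_le_of_lt ?_ hs)
    rw [mul_comm]
    refine mul_le_mul_of_nonneg_left ((hv x).trans ?_) (norm_nonneg _)
    linarith
  exact hu.continuous (Eventually.of_forall fun s => by fun_prop).frequently

/-- A subsequence of norm-convergent partial sums converges almost everywhere, and its limit has to
be the pointwise sum. -/
theorem MeasureTheory.Lp.ae_eq_of_hasSum {α : Type*} [MeasurableSpace α] {μ : Measure α}
    {F : ℤ → Lp ℂ 2 μ} {f : ℤ → α → ℂ} (hF : ∀ m, F m =ᵐ[μ] f m) {G : Lp ℂ 2 μ} {g : α → ℂ}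
    (hG : HasSum F G) (hg : ∀ x, HasSum (fun m => f m x) (g x)) : G =ᵐ[μ] g := by
  obtain ⟨s, hs⟩ := exists_seq_tendsto (atTop : Filter (Finset ℤ))
  have hG' : Tendsto (fun s => ∑ m ∈ s, F m) atTop (𝓝 G) := hG
  have hg' (x : α) : Tendsto (fun s => ∑ m ∈ s, f m x) atTop (𝓝 (g x)) := hg x
  have h1 : Tendsto (fun N => ∑ m ∈ s N, F m) atTop (𝓝 G) := hG'.comp hs
  obtain ⟨ns, hns, hae⟩ := (tendstoInMeasure_of_tendsto_Lp h1).exists_seq_tendsto_ae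
  have h2 : ∀ᵐ x ∂μ, ∀ N, (∑ m ∈ s N, F m : Lp ℂ 2 μ) x = ∑ m ∈ s N, f m x := by
    rw [ae_all_iff]
    intro N
    have h3 : ∀ᵐ x ∂μ, ∀ m, F m x = f m x := ae_all_iff.mpr hF
    filter_upwards [Lp.coeFn_finsetSum (s N) F, h3] with x h4 h5
    rw [h4, Finset.sum_apply]
    exact Finset.sum_congr rfl fun m _ => h5 m
  filter_upwards [hae, h2] with x h3 h4
  simp only [h4] at h3
  exact tendsto_nhds_unique h3 (((hg' x).comp hs).comp hns.tendsto_atTop)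

namespace Heis

open CircleL2

variable {n : ℕ}

theorem inv_lat (k l : Fin n → ℤ) (m : ℤ) : (lat k l m)⁻¹ = lat (-k) (-l) (-m) := by
  ext i <;> simp [lat]

/-- The two points over (k,l) differ by a central element, so (k,l) cancels. Only the central index
then depends on j, which reduces the values of g_{2k,l} to a convolution over ℤ. -/
theorem inv_lat_mul_lat_mul_lat (k l k' l' : Fin n → ℤ) (j m s : ℤ) :
    (lat k l j)⁻¹ * (lat k l m * lat k' l' s) = lat k' l' (s + m - j) := by
  have h : lat k l m = lat k l j * mk 0 0 ((m - j : ℤ) : ℝ) := by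
    rw [lat_mul_central, add_sub_cancel]
  rw [h, mul_assoc, inv_mul_cancel_left, central_mul_lat]
  congr 1
  ring

variable {φ : Heis n → ℂ}

theorem memℓp_lat (hsup : ∀ k l : Fin n → ℤ,
      (⨆ X : Heis n, ∑' m : ℤ, ‖leftTranslate (lat k l m) φ X‖ₑ ^ 2) < ⊤) (k l : Fin n → ℤ) :
    Memℓp (fun m => φ (lat k l m)) 2 := by
  refine memℓp_two_iff_tsum_enorm.mpr ?_
  -- At the identity, translates by points over (-k,-l) sample φ over (k,l), with the sign of m
  -- reversed.
  have h := (le_iSup (fun X => ∑' m : ℤ, ‖leftTranslate (lat (-k) (-l) m) φ X‖ₑ ^ 2) 1).trans_lt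
    (hsup (-k) (-l))
  rw [← (Equiv.neg ℤ).tsum_eq] at h
  simpa [leftTranslate, inv_lat] using h.ne

/-- Square summability is what makes the series defining `P` converge in L², so that its `tsum` is
not the default value. -/
theorem fourierCoeff_P {k l : Fin n → ℤ} (h : Memℓp (fun m => φ (lat k l m)) 2) (m : ℤ) :
    fourierCoeff (P φ k l) m = φ (lat k l m) := by
  have h1 := (fourierBasis (T := (1 : ℝ))).hasSum_repr_symm ⟨_, h⟩
  simp only [coe_fourierBasis] at h1
  have h2 : P φ k l = fourierBasis.repr.symm ⟨_, h⟩ := h1.tsum_eq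
  rw [h2, ← fourierBasis_repr, LinearIsometryEquiv.apply_symm_apply]

section Convolution

variable {ι : Type*} [Countable ι] {Q : ι → CircleL2} {p : AddCircle (1 : ℝ) → ℝ} {B : ℝ}

/-- Discrete convolution of `h` with the autocorrelation of the family `Q`, where
`p = ∑ |Q q|²` is bounded. -/
theorem hasSum_convolution (hp : ∀ᵐ z ∂AddCircle.haarAddCircle,
      HasSum (fun q => ‖Q q z‖ ^ 2) (p z) ∧ p z ≤ B) (h : CircleL2) (m : ℤ) :
    HasSum (fun a : ι × ℤ => fourierCoeff (fun z => h z * Q a.1 z) (a.2 + m) *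
      star (fourierCoeff (Q a.1) a.2)) (fourierCoeff (fun z => (p z : ℂ) * h z) m) := by
  have hpn : ∀ᵐ z ∂AddCircle.haarAddCircle, 0 ≤ p z := by
    filter_upwards [hp] with z hz
    exact hz.1.nonneg fun _ => by positivity
  have hB : 0 ≤ B := by
    obtain ⟨z, h1, h2⟩ := (hp.and hpn).exists
    exact h2.trans h1.2
  have hQ (q : ι) : ∀ᵐ z ∂AddCircle.haarAddCircle, ‖Q q z‖ ≤ √B := by
    filter_upwards [hp] with z hz
    exact Real.le_sqrt_of_sq_le ((le_hasSum hz.1 q fun _ _ => by positivity).trans hz.2)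
  let R (q : ι) : CircleL2 := mulCLM (Q q) (√B) (Lp.aestronglyMeasurable _) (hQ q) h
  have hR (q : ι) : R q =ᵐ[AddCircle.haarAddCircle] fun z => Q q z * h z := coeFn_mulCLM _ (hQ q) h
  have hpE : ∀ᵐ z ∂AddCircle.haarAddCircle, ∑' q, ‖Q q z‖ₑ ^ 2 ≤ ENNReal.ofReal B := by
    filter_upwards [hp] with z hz
    refine le_of_eq_of_le ?_ (ENNReal.ofReal_le_ofReal hz.2)
    rw [← hz.1.tsum_eq, ENNReal.ofReal_tsum_of_nonneg (fun _ => by positivity) hz.1.summable]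
    simp only [ENNReal.ofReal_pow (norm_nonneg _), ofReal_norm]
  have eR (q : ι) (s : ℤ) : fourierCoeff (fun z => h z * Q q z) s =
      inner ℂ (fourierLp 2 s) (R q) := by
    rw [inner_fourierLp]
    refine congrFun (fourierCoeff_congr_ae ?_) s
    filter_upwards [hR q] with z hz
    rw [hz, mul_comm]
  have mQ (q : ι) : AEMeasurable (fun z => ‖Q q z‖ₑ ^ 2) AddCircle.haarAddCircle :=
    (Lp.aestronglyMeasurable (Q q)).enorm.pow_const 2
  have mR (q : ι) : AEMeasurable (fun z => ‖R q z‖ₑ ^ 2) AddCircle.haarAddCircle :=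
    (Lp.aestronglyMeasurable (R q)).enorm.pow_const 2
  -- By Parseval and Tonelli this sum is the integral of ∑ |Q q|², which is at most B. The next one
  -- is likewise at most B‖h‖².
  have s1 : ∑' a : ι × ℤ, ‖fourierCoeff (Q a.1) a.2‖ₑ ^ 2 ≠ ⊤ := by
    simp only [ENNReal.tsum_prod', ← inner_fourierLp, tsum_enorm_inner_sq, Lp.enorm_sq]
    rw [← lintegral_tsum mQ]
    refine ((lintegral_mono_ae hpE).trans_lt ?_).ne
    simp
  have s2 : ∑' a : ι × ℤ, ‖fourierCoeff (fun z => h z * Q a.1 z) (a.2 + m)‖ₑ ^ 2 ≠ ⊤ := by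
    simp only [ENNReal.tsum_prod', eR]
    have e (q : ι) : ∑' s : ℤ, ‖inner ℂ (fourierLp 2 (s + m)) (R q)‖ₑ ^ 2 = ‖R q‖ₑ ^ 2 := by
      rw [← tsum_enorm_inner_sq]
      exact (Equiv.addRight m).tsum_eq fun s => ‖inner ℂ (fourierLp 2 s) (R q)‖ₑ ^ 2
    simp only [e, Lp.enorm_sq]
    rw [← lintegral_tsum mR]
    have hb : ∀ᵐ z ∂AddCircle.haarAddCircle, ∑' q, ‖R q z‖ₑ ^ 2 ≤ ENNReal.ofReal B * ‖h z‖ₑ ^ 2 :=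
        by
      filter_upwards [hpE, ae_all_iff.mpr hR] with z h1 h2
      simp only [h2, enorm_mul, mul_pow, ENNReal.tsum_mul_right]
      gcongr
    refine ((lintegral_mono_ae hb).trans_lt ?_).ne
    rw [lintegral_const_mul' _ _ ENNReal.ofReal_ne_top, ← Lp.enorm_sq]
    exact ENNReal.mul_lt_top ENNReal.ofReal_lt_top (ENNReal.pow_lt_top enorm_lt_top)
  -- Two square-summable families have an absolutely summable product, which permits summing first
  -- over the integer index.
  have s3 : Summable fun a : ι × ℤ => fourierCoeff (fun z => h z * Q a.1 z) (a.2 + m) *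
      star (fourierCoeff (Q a.1) a.2) := by
    have t1 := ENNReal.summable_toReal s1
    have t2 := ENNReal.summable_toReal s2
    simp only [ENNReal.toReal_pow, toReal_enorm] at t1 t2
    refine Summable.of_norm (Summable.of_nonneg_of_le (fun _ => norm_nonneg _) (fun a => ?_)
      (t1.add t2))
    rw [norm_mul, norm_star]
    nlinarith [sq_nonneg (‖fourierCoeff (fun z => h z * Q a.1 z) (a.2 + m)‖ -
      ‖fourierCoeff (Q a.1) a.2‖), sq_nonneg ‖fourierCoeff (fun z => h z * Q a.1 z) (a.2 + m)‖,
      sq_nonneg ‖fourierCoeff (Q a.1) a.2‖]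
  -- For fixed q this is Parseval for the pairing of Q q with e_{-m} h Q q.
  have s4 (q : ι) : HasSum (fun s : ℤ => fourierCoeff (fun z => h z * Q q z) (s + m) *
      star (fourierCoeff (Q q) s))
      (∫ z, _root_.fourier (-m) z * (((‖Q q z‖ ^ 2 : ℝ) : ℂ) * h z) ∂AddCircle.haarAddCircle) := by
    have h1 := fourierBasis.hasSum_inner_mul_inner (Q q) (mulFourier (-m) (R q))
    rw [coe_fourierBasis] at h1
    have e1 : (fun s : ℤ => fourierCoeff (fun z => h z * Q q z) (s + m) *
        star (fourierCoeff (Q q) s)) = fun s => inner ℂ (Q q) (fourierLp 2 s) *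
          inner ℂ (fourierLp 2 s) (mulFourier (-m) (R q)) := by
      funext s
      rw [← inner_conj_symm (Q q), inner_fourierLp, mul_comm]
      congr 1
      rw [eR, inner_fourierLp, inner_fourierLp]
      unfold fourierCoeff
      refine integral_congr_ae ?_
      filter_upwards [coeFn_mulFourier (-m) (R q)] with z hz
      rw [hz, neg_add, fourier_add, smul_eq_mul, smul_eq_mul, mul_assoc]
    have e2 : inner ℂ (Q q) (mulFourier (-m) (R q)) = ∫ z, _root_.fourier (-m) z *
        (((‖Q q z‖ ^ 2 : ℝ) : ℂ) * h z) ∂AddCircle.haarAddCircle := by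
      rw [L2.inner_def]
      refine integral_congr_ae ?_
      filter_upwards [coeFn_mulFourier (-m) (R q), hR q] with z h2 h3
      rw [h2, h3, RCLike.inner_apply]
      have : (((‖Q q z‖ ^ 2 : ℝ) : ℂ)) = Q q z * (starRingEnd ℂ) (Q q z) := by
        rw [Complex.mul_conj, Complex.normSq_eq_norm_sq]
      rw [this]
      ring
    rw [e1, ← e2]
    exact h1
  have hn (z : AddCircle (1 : ℝ)) : ‖_root_.fourier (-m) z‖ = 1 := by
    rw [fourier_apply, Circle.norm_coe]
  have hi : Integrable (fun z => ‖h z‖) AddCircle.haarAddCircle :=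
    ((Lp.memLp h).integrable (by norm_num)).norm
  -- The sum over q enters the integral by dominated convergence, the sums being dominated by p|h| ≤
  -- B|h|.
  have s5 : HasSum (fun q => ∫ z, _root_.fourier (-m) z * (((‖Q q z‖ ^ 2 : ℝ) : ℂ) * h z)
      ∂AddCircle.haarAddCircle) (fourierCoeff (fun z => (p z : ℂ) * h z) m) := by
    unfold fourierCoeff
    refine hasSum_integral_of_dominated_convergence (fun q z => ‖Q q z‖ ^ 2 * ‖h z‖) (fun q => ?_)
      (fun q => Eventually.of_forall fun z => ?_) ?_ ?_ ?_
    · refine AEStronglyMeasurable.mul (_root_.fourier (-m)).continuous.aestronglyMeasurable ?_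
      refine AEStronglyMeasurable.mul ?_ (Lp.aestronglyMeasurable h)
      exact Complex.continuous_ofReal.comp_aestronglyMeasurable
        ((Lp.aestronglyMeasurable (Q q)).norm.pow 2)
    · rw [norm_mul, norm_mul, hn, one_mul, Complex.norm_real, norm_pow, norm_norm]
    · filter_upwards [hp] with z hz
      exact hz.1.summable.mul_right _
    · have e : (fun z => ∑' q, ‖Q q z‖ ^ 2 * ‖h z‖) =ᵐ[AddCircle.haarAddCircle]
          fun z => p z * ‖h z‖ := by
        filter_upwards [hp] with z hz
        rw [tsum_mul_right, hz.1.tsum_eq]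
      refine (hi.const_mul B).mono' ?_ ?_
      · refine aestronglyMeasurable_of_tendsto_ae (atTop : Filter (Finset ι))
          (f := fun s z => ∑ q ∈ s, ‖Q q z‖ ^ 2 * ‖h z‖) (fun s => ?_) ?_
        · exact Finset.aestronglyMeasurable_fun_sum _ fun q _ =>
            ((Lp.aestronglyMeasurable (Q q)).norm.pow 2).mul (Lp.aestronglyMeasurable h).norm
        · filter_upwards [hp] with z hz
          exact (hz.1.summable.mul_right _).hasSum
      · filter_upwards [e, hp, hpn] with z h1 h2 h3
        rw [h1, norm_mul, norm_norm, Real.norm_eq_abs, abs_of_nonneg h3]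
        exact mul_le_mul_of_nonneg_right h2.2 (norm_nonneg _)
    · filter_upwards [hp] with z hz
      have := ((Complex.hasSum_ofReal.mpr hz.1).mul_right (h z)).mul_left (_root_.fourier (-m) z)
      exact this
  have s6 := s3.hasSum.prod_fiberwise s4
  rw [← s6.unique s5]
  exact s3.hasSum

end Convolution

end Heis

end

/-! ### The coefficients α and the transfer of expansions to ψ. -/

section

open scoped lp

namespace Heis

open CircleL2

variable {n : ℕ} {φ : Heis n → ℂ}

theorem continuous_mul_left (a : Heis n) : Continuous fun X : Heis n => a * X := by
  change Continuous fun p : (Fin n → ℝ) × (Fin n → ℝ) × ℝ =>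
    (a.x + p.1, a.y + p.2.1, a.t + p.2.2 + (1 / 2) * (p.1 ⬝ᵥ a.y - p.2.1 ⬝ᵥ a.x))
  simp only [dotProduct]
  fun_prop

section Convolution

variable {p : AddCircle (1 : ℝ) → ℝ} {B : ℝ}

theorem hasSum_discreteConv (hmem : ∀ k l : Fin n → ℤ, Memℓp (fun m => φ (lat k l m)) 2)
    (hp : ∀ᵐ z ∂AddCircle.haarAddCircle,
      HasSum (fun q : (Fin n → ℤ) × (Fin n → ℤ) => ‖P φ q.1 q.2 z‖ ^ 2) (p z) ∧ p z ≤ B)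
    {h : CircleL2} {k l : Fin n → ℤ} {g : Heis n → ℂ}
    (hg : ∀ X, HasSum (fun m => fourierCoeff h m * leftTranslate (lat k l m) φ X) (g X)) (m : ℤ) :
    HasSum (fun q : (Fin n → ℤ) × (Fin n → ℤ) × ℤ => g (lat k l m * (lat q.1 q.2.1 q.2.2)⁻¹) *
      involution φ (lat q.1 q.2.1 q.2.2)) (fourierCoeff (fun z => (p z : ℂ) * h z) m) := by
  have e (k' l' : Fin n → ℤ) (s : ℤ) : g (lat k l m * lat k' l' s) =
      fourierCoeff (fun z => h z * P φ k' l' z) (s + m) := by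
    refine (hg _).unique ?_
    have h1 := hasSum_fourierCoeff_mul h (P φ k' l') (s + m)
    simp only [fourierCoeff_P (hmem k' l')] at h1
    simp only [leftTranslate, inv_lat_mul_lat_mul_lat]
    exact h1
  have h1 := hasSum_convolution (Q := fun q : (Fin n → ℤ) × (Fin n → ℤ) => P φ q.1 q.2) hp h m
  -- Negating all indices matches both the inverse lattice point in the convolution and the inverse
  -- inside the involution.
  rw [← (Equiv.prodAssoc (Fin n → ℤ) (Fin n → ℤ) ℤ).symm.hasSum_iff,
    ← (Equiv.neg ((Fin n → ℤ) × (Fin n → ℤ) × ℤ)).hasSum_iff] at h1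
  refine h1.congr_fun fun q => ?_
  obtain ⟨k', l', s⟩ := q
  change _ = fourierCoeff (fun z => h z * P φ (-k') (-l') z) (-s + m) *
    star (fourierCoeff (P φ (-k') (-l')) (-s))
  rw [← e, fourierCoeff_P (hmem _ _), involution, inv_lat]

end Convolution

/-- `∑ |P_{k,l}|²` as a function on the circle. -/
noncomputable def normSqPCircle (φ : Heis n → ℂ) (z : AddCircle (1 : ℝ)) : ℝ :=
  (∑' q : (Fin n → ℤ) × (Fin n → ℤ), ‖P φ q.1 q.2 z‖ₑ ^ 2).toReal

theorem aestronglyMeasurable_normSqPCircle :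
    AEStronglyMeasurable (normSqPCircle φ) AddCircle.haarAddCircle := by
  refine AEMeasurable.aestronglyMeasurable (AEMeasurable.ennreal_toReal ?_)
  exact AEMeasurable.tsum fun q => (Lp.aestronglyMeasurable (P φ q.1 q.2)).enorm.pow_const 2

variable {A B : ℝ}

theorem normSqP_circle (hP : ∀ᵐ lam : ℝ,
      (Omega φ).indicator (fun _ => ENNReal.ofReal A) lam ≤ normSqP φ lam ∧
      normSqP φ lam ≤ (Omega φ).indicator (fun _ => ENNReal.ofReal B) lam) :
    ∀ᵐ z ∂AddCircle.haarAddCircle,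
      (weight φ z ≠ 0 →
        ENNReal.ofReal A ≤ ∑' q : (Fin n → ℤ) × (Fin n → ℤ), ‖P φ q.1 q.2 z‖ₑ ^ 2 ∧
        ∑' q : (Fin n → ℤ) × (Fin n → ℤ), ‖P φ q.1 q.2 z‖ₑ ^ 2 ≤ ENNReal.ofReal B) ∧
      (weight φ z = 0 → ∑' q : (Fin n → ℤ) × (Fin n → ℤ), ‖P φ q.1 q.2 z‖ₑ ^ 2 = 0) := by
  filter_upwards [ae_circle_of_ae_real (ae_restrict_of_ae hP)] with z hz
  simp only [normSqP, coe_circleRep] at hz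
  have hiff : circleRep z ∈ Omega φ ↔ 0 < weight φ z := by rw [mem_Omega_iff, coe_circleRep]
  constructor
  · intro hw
    have h := hiff.mpr ((periodization_eq_weight φ z).1.lt_of_ne' hw)
    rwa [Set.indicator_of_mem h, Set.indicator_of_mem h] at hz
  · intro hw
    have h : circleRep z ∉ Omega φ := fun h => (hiff.mp h).ne' hw
    rw [Set.indicator_of_notMem h, Set.indicator_of_notMem h] at hz
    -- Off Ω_φ both indicators are 0, which forces p = 0 there; the multiplier 1/p relies on this.
    exact le_antisymm hz.2 hz.1

theorem hasSum_normSqPCircle (hB : 0 ≤ B) (hP : ∀ᵐ lam : ℝ,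
      (Omega φ).indicator (fun _ => ENNReal.ofReal A) lam ≤ normSqP φ lam ∧
      normSqP φ lam ≤ (Omega φ).indicator (fun _ => ENNReal.ofReal B) lam) :
    ∀ᵐ z ∂AddCircle.haarAddCircle,
      HasSum (fun q : (Fin n → ℤ) × (Fin n → ℤ) => ‖P φ q.1 q.2 z‖ ^ 2) (normSqPCircle φ z) ∧
        normSqPCircle φ z ≤ B := by
  filter_upwards [normSqP_circle hP] with z hz
  have h : ∑' q : (Fin n → ℤ) × (Fin n → ℤ), ‖P φ q.1 q.2 z‖ₑ ^ 2 ≤ ENNReal.ofReal B := by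
    by_cases hw : weight φ z = 0
    · rw [hz.2 hw]
      exact zero_le
    · exact (hz.1 hw).2
  refine ⟨?_, ENNReal.toReal_le_of_le_ofReal hB h⟩
  have h1 := ENNReal.hasSum_toReal (h.trans_lt ENNReal.ofReal_lt_top).ne
  simp only [ENNReal.toReal_pow, toReal_enorm] at h1
  rw [normSqPCircle, ENNReal.tsum_toReal_eq fun q => by simp]
  simpa only [ENNReal.toReal_pow, toReal_enorm] using h1

theorem exists_isMultiplierPair_normSqPCircle (hA : 0 < A) (hB : 0 < B) (hP : ∀ᵐ lam : ℝ,
      (Omega φ).indicator (fun _ => ENNReal.ofReal A) lam ≤ normSqP φ lam ∧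
      normSqP φ lam ≤ (Omega φ).indicator (fun _ => ENNReal.ofReal B) lam) :
    ∃ Mp Mb, IsMultiplierPair φ (normSqPCircle φ) A B Mp Mb := by
  refine exists_isMultiplierPair hA hB aestronglyMeasurable_normSqPCircle ?_ ?_
  · filter_upwards [normSqP_circle hP] with z hz hw
    have h := hz.1 hw
    exact ⟨(ENNReal.ofReal_le_iff_le_toReal (h.2.trans_lt ENNReal.ofReal_lt_top).ne).mp h.1,
      ENNReal.toReal_le_of_le_ofReal hB.le h.2⟩
  · filter_upwards [normSqP_circle hP] with z hz hw
    rw [normSqPCircle, hz.2 hw, ENNReal.toReal_zero]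

theorem exists_fourierCoeff_eq {c : ℤ → ℂ} (hc : Memℓp c 2) :
    ∃ h : CircleL2, ∀ m, fourierCoeff h m = c m := by
  refine ⟨fourierBasis.repr.symm ⟨c, hc⟩, fun m => ?_⟩
  rw [← fourierBasis_repr, LinearIsometryEquiv.apply_symm_apply]

theorem _root_.Memℓp.comp_injective {ι κ : Type*} {c : ι → ℂ} (hc : Memℓp c 2) {f : κ → ι}
    (hf : Function.Injective f) : Memℓp (fun i => c (f i)) 2 := by
  rw [memℓp_two_iff_tsum_enorm] at hc ⊢
  exact ((ENNReal.tsum_comp_le_tsum_of_injective hf (fun i => ‖c i‖ₑ ^ 2)).trans_lt hc.lt_top).ne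

theorem _root_.HasSum.prod_assoc_fiberwise {α β γ E : Type*} [AddCommMonoid E]
    [TopologicalSpace E] [ContinuousAdd E] [RegularSpace E] {f : α × β × γ → E} {g : α × β → E}
    {a : E} (h : HasSum f a) (hg : ∀ q : α × β, HasSum (fun c => f (q.1, q.2, c)) (g q)) :
    HasSum g a :=
  HasSum.prod_fiberwise ((Equiv.prodAssoc α β γ).hasSum_iff.mpr h) hg

theorem _root_.IsFrameFor.summable_smul {E ι : Type*} [NormedAddCommGroup E]
    [InnerProductSpace ℂ E] [CompleteSpace E] {V : Submodule ℂ E} (hV : IsClosed (V : Set E))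
    {e : ι → E} (h : IsFrameFor V e) {c : ι → ℂ} (hc : Memℓp c 2) :
    Summable fun i => c i • e i := by
  have : CompleteSpace V := hV.completeSpace_coe
  obtain ⟨he, a, b, ha, hb, hab⟩ := h
  obtain ⟨T, -, hT⟩ := exists_synthesis he fun f hf => (hab f hf).2
  exact (hT ⟨c, hc⟩).summable

/-- Transfer of an `ℓ²` expansion from `φ` to the dual window `ψ`. -/
theorem hasSum_dual {V : Submodule ℂ (L2 n)} (hV : IsClosed (V : Set (L2 n)))
    {hφ : MemLp φ 2 volume} {S : CircleL2 →L[ℂ] L2 n} {p : AddCircle (1 : ℝ) → ℝ}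
    {Mp Mb : CircleL2 →L[ℂ] CircleL2} {ψ : Heis n → ℂ} {hψ : MemLp ψ 2 volume}
    (hM : IsMultiplierPair φ p A B Mp Mb)
    (hS : ∀ m, S (fourierLp 2 m) = latticeTranslates hφ (0, 0, m))
    (hψS : hψ.toLp = S (Mb (fourierLp 2 0))) (hF : IsFrameFor V (latticeTranslates hψ))
    {c : (Fin n → ℤ) × (Fin n → ℤ) × ℤ → ℂ} (hc : Memℓp c 2)
    {H : (Fin n → ℤ) → (Fin n → ℤ) → CircleL2} (hH : ∀ k l m, fourierCoeff (H k l) m = c (k, l, m))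
    {f : L2 n}
    (hf : HasSum (fun q : (Fin n → ℤ) × (Fin n → ℤ) => translate (lat q.1 q.2 0) (S (H q.1 q.2)))
        f) :
    HasSum (fun q : (Fin n → ℤ) × (Fin n → ℤ) × ℤ =>
      fourierCoeff (Mp (H q.1 q.2.1)) q.2.2 • latticeTranslates hψ q) f := by
  have hmem : Memℓp (fun q : (Fin n → ℤ) × (Fin n → ℤ) × ℤ =>
      fourierCoeff (Mp (H q.1 q.2.1)) q.2.2) 2 := by
    rw [memℓp_two_iff_tsum_enorm] at hc ⊢
    have hle : ∑' q : (Fin n → ℤ) × (Fin n → ℤ) × ℤ, ‖fourierCoeff (Mp (H q.1 q.2.1)) q.2.2‖ₑ ^ 2 ≤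
        ENNReal.ofReal (B ^ 2) * ∑' q, ‖c q‖ₑ ^ 2 := by
      simp only [ENNReal.tsum_prod', ← hH, ← inner_fourierLp, tsum_enorm_inner_sq,
        ← ENNReal.tsum_mul_left]
      exact ENNReal.tsum_le_tsum fun k => ENNReal.tsum_le_tsum fun l =>
        enorm_sq_le_of_norm_le hM.pos_right.le (hM.norm_left _)
    exact (hle.trans_lt (ENNReal.mul_lt_top ENNReal.ofReal_lt_top hc.lt_top)).ne
  -- The Bessel bound for ψ gives convergence over the whole lattice to some limit; summing block by
  -- block identifies this limit with f.
  have h1 := (hF.summable_smul hV hmem).hasSum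
  have h2 := h1.prod_assoc_fiberwise fun q =>
    hasSum_latticeTranslates_dual hM hS hψS q.1 q.2 (H q.1 q.2)
  rw [← h2.unique hf]
  exact h1

end Heis

end

/-! ### Assembly of the theorem. -/

theorem mainTheorem2 (n : ℕ)
    (V₀ : Submodule ℂ (Heis.L2 n)) (hV₀ : IsClosed (V₀ : Set (Heis.L2 n)))
    (φ : Heis n → ℂ) (hφ : MemLp φ 2 volume) (hC : Heis.ConditionC φ)
    (hframe : IsFrameFor V₀ (Heis.latticeTranslates hφ))
    (hcont : Continuous φ)
    (hsup : ∀ k l : Fin n → ℤ,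
      (⨆ X : Heis n, ∑' m : ℤ, ‖Heis.leftTranslate (Heis.lat k l m) φ X‖ₑ ^ 2) < ⊤)
    (A B : ℝ) (hA : 0 < A) (hB : 0 < B)
    (hP : ∀ᵐ lam : ℝ,
      (Heis.Omega φ).indicator (fun _ => ENNReal.ofReal A) lam ≤ Heis.normSqP φ lam ∧
      Heis.normSqP φ lam ≤ (Heis.Omega φ).indicator (fun _ => ENNReal.ofReal B) lam) :
    (∀ (k l : Fin n → ℤ) (c : ℤ → ℂ), Memℓp c 2 →
      ∃ g : Heis n → ℂ, Continuous g ∧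
        ∀ X, HasSum (fun m : ℤ => c m * Heis.leftTranslate (Heis.lat k l m) φ X) (g X)) ∧
    ∃ (ψ : Heis n → ℂ) (hψ : MemLp ψ 2 volume),
      Heis.ConditionC ψ ∧ IsFrameFor V₀ (Heis.latticeTranslates hψ) ∧
      ∀ f ∈ V₀,
        (∃ c : (Fin n → ℤ) × (Fin n → ℤ) × ℤ → ℂ,
          Memℓp c 2 ∧ HasSum (fun p => c p • Heis.latticeTranslates hφ p) f) ∧
        ∀ c : (Fin n → ℤ) × (Fin n → ℤ) × ℤ → ℂ, Memℓp c 2 →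
          HasSum (fun p => c p • Heis.latticeTranslates hφ p) f →
          ∃ (g : (Fin n → ℤ) → (Fin n → ℤ) → Heis n → ℂ)
            (hg : ∀ k l, MemLp (g k l) 2 volume),
            (∀ k l, Continuous (g k l)) ∧
            (∀ k l X, HasSum (fun m : ℤ => c (k, l, m) * Heis.leftTranslate (Heis.lat k l m) φ X)
              (g k l X)) ∧
            (∀ k l, HasSum (fun m : ℤ => c (k, l, m) • Heis.latticeTranslates hφ (k, l, m))
              (hg k l).toLp) ∧
            HasSum (fun q : (Fin n → ℤ) × (Fin n → ℤ) => (hg q.1 q.2).toLp) f ∧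
            (∀ k l m, Summable fun p : (Fin n → ℤ) × (Fin n → ℤ) × ℤ =>
              g k l (Heis.lat k l m * (Heis.lat p.1 p.2.1 p.2.2)⁻¹) *
                Heis.involution φ (Heis.lat p.1 p.2.1 p.2.2)) ∧
            HasSum (fun p : (Fin n → ℤ) × (Fin n → ℤ) × ℤ =>
              Heis.discreteConv (g p.1 p.2.1) (Heis.involution φ) (Heis.lat p.1 p.2.1 p.2.2) •
                Heis.latticeTranslates hψ p) f := by
  have hpart1 : ∀ (k l : Fin n → ℤ) (c : ℤ → ℂ), Memℓp c 2 →
      ∃ g : Heis n → ℂ, Continuous g ∧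
        ∀ X, HasSum (fun m : ℤ => c m * Heis.leftTranslate (Heis.lat k l m) φ X) (g X) :=
    fun k l c hc => exists_continuous_hasSum_of_bounded
      (fun m => hcont.comp (Heis.continuous_mul_left _)) (hsup k l) hc
  obtain ⟨Mp, Mb, hM⟩ := Heis.exists_isMultiplierPair_normSqPCircle hA hB hP
  obtain ⟨S, hS⟩ := Heis.exists_circleSynthesis hφ hV₀ hframe
  -- The character of index 0 is the constant 1, so this window is S(1/p).
  have hψ : MemLp (S (Mb (fourierLp 2 0))) 2 volume := Lp.memLp _
  have hψS : hψ.toLp = S (Mb (fourierLp 2 0)) := Lp.toLp_coeFn _ _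
  have hF := Heis.isFrameFor_dual hV₀ hframe hM hS hψS
  refine ⟨hpart1, _, hψ, Heis.conditionC_dual hC hM hS hψS, hF, fun f hf =>
    ⟨hframe.exists_hasSum hV₀ hf, fun c hc hcf => ?_⟩⟩
  have hckl (k l : Fin n → ℤ) : Memℓp (fun m => c (k, l, m)) 2 :=
    hc.comp_injective (f := fun m => (k, l, m)) fun m m' h => by simpa using h
  choose g hgc hgs using fun k l => hpart1 k l _ (hckl k l)
  choose H hH using fun k l => Heis.exists_fourierCoeff_eq (hckl k l)
  have hG (k l : Fin n → ℤ) :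
      HasSum (fun m : ℤ => c (k, l, m) • Heis.latticeTranslates hφ (k, l, m))
        (Heis.translate (Heis.lat k l 0) (S (H k l))) := by
    simpa only [hH] using Heis.hasSum_translate_circleSynthesis hS k l (H k l)
  have hae (k l : Fin n → ℤ) : Heis.translate (Heis.lat k l 0) (S (H k l)) =ᵐ[volume] g k l := by
    refine Lp.ae_eq_of_hasSum (fun m => ?_) (hG k l) (hgs k l)
    filter_upwards [Lp.coeFn_smul (c (k, l, m)) (Heis.latticeTranslates hφ (k, l, m)),
      (Heis.memLp_leftTranslate (Heis.lat k l m) hφ).coeFn_toLp] with X h1 h2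
    rw [h1, Pi.smul_apply, smul_eq_mul]
    exact congrArg _ h2
  have hg (k l : Fin n → ℤ) : MemLp (g k l) 2 volume := (memLp_congr_ae (hae k l)).mp (Lp.memLp _)
  have hgG (k l : Fin n → ℤ) : (hg k l).toLp = Heis.translate (Heis.lat k l 0) (S (H k l)) :=
    Lp.ext ((hg k l).coeFn_toLp.trans (hae k l).symm)
  have hsum : HasSum (fun q : (Fin n → ℤ) × (Fin n → ℤ) =>
      Heis.translate (Heis.lat q.1 q.2 0) (S (H q.1 q.2))) f :=
    hcf.prod_assoc_fiberwise fun q => hG q.1 q.2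
  have hconv (k l : Fin n → ℤ) (m : ℤ) := Heis.hasSum_discreteConv (Heis.memℓp_lat hsup)
    (Heis.hasSum_normSqPCircle hB.le hP) (h := H k l) (k := k) (l := l) (g := g k l)
    (by simpa only [hH] using hgs k l) m
  refine ⟨g, hg, hgc, hgs, fun k l => ?_, ?_, fun k l m => (hconv k l m).summable, ?_⟩
  · rw [hgG]
    exact hG k l
  · simpa only [hgG] using hsum
  -- The convolution coefficients are the Fourier coefficients of p h in each block, exactly those
  -- with which ψ reproduces f.
  · have e (q : (Fin n → ℤ) × (Fin n → ℤ) × ℤ) :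
        Heis.discreteConv (g q.1 q.2.1) (Heis.involution φ) (Heis.lat q.1 q.2.1 q.2.2) =
          fourierCoeff (Mp (H q.1 q.2.1)) q.2.2 :=
      (hconv q.1 q.2.1 q.2.2).tsum_eq.trans
        (congrFun (fourierCoeff_congr_ae (hM.coeFn_left _).symm) _)
    simp only [e]
    exact Heis.hasSum_dual hV₀ hM hS hψS hF hc hH hsum
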